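/- Let $G$ be a finite simple graph on $n\ge 4$ vertices that contains no cycle $C_4$ of length 4 as a subgraph, and let $G$ be embedded in the plane (vertices are distinct points; each edge is a simple arc joining its two ends and passing through no other vertex; two different edges meet at most in common ends). Let $\varepsilon(G)$ be the number of edges of $G$. The faces are the connected components of the complement of the drawing, the length of a face is the number of edges on its boundary, bridges being counted twice, $f_k$ is the number of faces of length $k$, and $r$ is the maximum length of a face. Let $\tau(G)$ be the number of edges that do not lie on the boundary of any triangular face (face of length 3). Then $$\varepsilon(G)\le \frac{15}{7}(n-2),$$ and if $G$ is connected, then there are finitely many faces and $$\varepsilon(G)=\frac{15}{7}(n-2)-\frac{2}{7}\tau(G)-\sum_{k=6}^{r}\frac{3(k-5)}{7}f_k .$$ Moreover, if $G$ is connected and every triangle (cycle of length 3) of $G$ is the boundary of a face, then $\tau(G)$ equals the number of edges of $G$ that are contained in no triangle of $G$. -/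

import Mathlib

/-- `A` is a simple arc in the plane with end points `p` and `q`: the image of a continuous
injective map of the unit interval that starts at `p` and stops at `q`. -/
def IsPlaneArc (p q : ℂ) (A : Set ℂ) : Prop :=
  ∃ γ : unitInterval → ℂ,
    Continuous γ ∧ Function.Injective γ ∧ γ 0 = p ∧ γ 1 = q ∧ Set.range γ = A

/-- An embedding of the graph `G` in the plane (the complex plane): distinct vertices are
distinct points, every edge is a simple arc that joins its two end vertices and contains no other
vertex, and two different edges meet at most in common end vertices.
The value of `arc` at unordered pairs that are not edges of `G` plays no role. -/
structure PlaneEmbedding {V : Type*} (G : SimpleGraph V) where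
  /-- the point that represents a vertex -/
  point : V → ℂ
  /-- the arc that represents an edge -/
  arc : Sym2 V → Set ℂ
  point_injective : Function.Injective point
  isPlaneArc : ∀ u v : V, G.Adj u v → IsPlaneArc (point u) (point v) (arc s(u, v))
  mem_of_point_mem_arc : ∀ e ∈ G.edgeSet, ∀ w : V, point w ∈ arc e → w ∈ e
  arc_inter_arc : ∀ e ∈ G.edgeSet, ∀ e' ∈ G.edgeSet, e ≠ e' →
    arc e ∩ arc e' ⊆ point '' {w | w ∈ e ∧ w ∈ e'}

namespace PlaneEmbedding

/-- The set of points of the plane that are covered by the drawing of `G`. -/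
def support {V : Type*} {G : SimpleGraph V} (D : PlaneEmbedding G) : Set ℂ :=
  Set.range D.point ∪ ⋃ e ∈ G.edgeSet, D.arc e

/-- The faces: the connected components of the complement of the drawing. -/
def faces {V : Type*} {G : SimpleGraph V} (D : PlaneEmbedding G) : Set (Set ℂ) :=
  {F | ∃ x ∈ D.supportᶜ, F = connectedComponentIn D.supportᶜ x}

/-- The edges of `G` that lie on the boundary of `F`. -/
def boundaryEdges {V : Type*} {G : SimpleGraph V} (D : PlaneEmbedding G) (F : Set ℂ) :
    Set (Sym2 V) :=
  {e | e ∈ G.edgeSet ∧ D.arc e ⊆ frontier F}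

/-- The length of a face: the number of edges on its boundary, bridges being counted twice. -/
noncomputable def faceLength {V : Type*} {G : SimpleGraph V} (D : PlaneEmbedding G)
    (F : Set ℂ) : ℕ :=
  (D.boundaryEdges F).ncard + {e | e ∈ D.boundaryEdges F ∧ G.IsBridge e}.ncard

/-- `f_k`: the number of faces of length `k`. -/
noncomputable def numFaces {V : Type*} {G : SimpleGraph V} (D : PlaneEmbedding G) (k : ℕ) : ℕ :=
  {F | F ∈ D.faces ∧ D.faceLength F = k}.ncard

/-- `r`: the maximum length of a face. -/
noncomputable def maxFaceLength {V : Type*} {G : SimpleGraph V} (D : PlaneEmbedding G) : ℕ :=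
  sSup (D.faceLength '' D.faces)

/-- `Γ`: the edges that do not lie on the boundary of any triangular face (face of length 3). -/
def uncoveredEdges {V : Type*} {G : SimpleGraph V} (D : PlaneEmbedding G) : Set (Sym2 V) :=
  {e | e ∈ G.edgeSet ∧ ¬ ∃ F ∈ D.faces, D.faceLength F = 3 ∧ e ∈ D.boundaryEdges F}

/-- `τ`: the number of edges that do not lie on the boundary of any triangular face. -/
noncomputable def tau {V : Type*} {G : SimpleGraph V} (D : PlaneEmbedding G) : ℕ :=
  D.uncoveredEdges.ncard

/-- Every triangle (cycle of length 3) of `G` is the boundary of some face. -/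
def TrianglesBoundFaces {V : Type*} {G : SimpleGraph V} (D : PlaneEmbedding G) : Prop :=
  ∀ u v w : V, G.Adj u v → G.Adj v w → G.Adj w u →
    ∃ F ∈ D.faces, D.boundaryEdges F = {s(u, v), s(v, w), s(w, u)}

end PlaneEmbedding

/-- The edges of `G` that are contained in no triangle (cycle of length 3) of `G`. -/
def edgesInNoTriangle {V : Type*} (G : SimpleGraph V) : Set (Sym2 V) :=
  {e | e ∈ G.edgeSet ∧ ¬ ∃ u v w : V, G.Adj u v ∧ G.Adj v w ∧ G.Adj w u ∧ e = s(u, v)}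

/-!
Euler's formula `f + n = ε + 1 + c`, with `c` the number of components, is combined with double
counting of the incidences between edges and faces. Summing lengths counts every edge twice:
`∑ k f_k = 2ε`. Without a `C₄`, and unless the edges of `G` form a single triangle or number less
than three, no two triangular faces share an edge, so `3 f₃ + τ = ε`, and every other face has
length at least `5`. Eliminating `f` and `f₃` from these relations leaves
`7ε = 15 (n - 1 - c) - 2τ - 3 ∑ (k - 5) f_k`.

The topological input concerns an arc that meets a compact set `K` in its two ends only. If `K`
joins the ends, the arc splits one component of the complement of `K` into two; if the ends lie in
different components of `K`, it separates nothing. Both facts come from continuous logarithms. A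
continuous nonvanishing function that is constant near infinity has a logarithm off one point, and
off two points it has one up to a single winding number. Applied to the Mayer-Vietoris coboundary
of a function that is locally constant off `X ∪ Y`, this yields Janiszewski's theorem on compact
sets `X` and `Y` neither of which separates two given points.
-/

open Set Filter Topology Bornology

/-- Two points are linked in `U` if they lie in the same connected component of `U`. The relation
is phrased through a connecting set, so that it can be transported along inclusions. -/
def Linked {α : Type*} [TopologicalSpace α] (U : Set α) (x y : α) : Prop :=
  ∃ C ⊆ U, IsPreconnected C ∧ x ∈ C ∧ y ∈ C

namespace Linked

variable {α : Type*} [TopologicalSpace α] {U W : Set α} {x y z : α}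

theorem left_mem (h : Linked U x y) : x ∈ U := by
  obtain ⟨C, hCU, -, hx, -⟩ := h
  exact hCU hx

theorem symm (h : Linked U x y) : Linked U y x := by
  obtain ⟨C, hCU, hC, hx, hy⟩ := h
  exact ⟨C, hCU, hC, hy, hx⟩

theorem mono (h : Linked U x y) (hUW : U ⊆ W) : Linked W x y := by
  obtain ⟨C, hCU, hC, hx, hy⟩ := h
  exact ⟨C, hCU.trans hUW, hC, hx, hy⟩

theorem refl (h : x ∈ U) : Linked U x x :=
  ⟨{x}, singleton_subset_iff.2 h, isPreconnected_singleton, rfl, rfl⟩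

theorem trans (h : Linked U x y) (h' : Linked U y z) : Linked U x z := by
  obtain ⟨C, hCU, hC, hx, hy⟩ := h
  obtain ⟨C', hCU', hC', hy', hz⟩ := h'
  exact ⟨C ∪ C', union_subset hCU hCU', hC.union y hy hy' hC', Or.inl hx, Or.inr hz⟩

end Linked

section Components

variable {α : Type*} [TopologicalSpace α] {U : Set α} {x y z : α}

theorem linked_iff_mem_connectedComponentIn :
    Linked U x y ↔ x ∈ U ∧ y ∈ connectedComponentIn U x := by
  constructor
  · rintro ⟨C, hCU, hC, hx, hy⟩
    exact ⟨hCU hx, hC.subset_connectedComponentIn hx hCU hy⟩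
  · rintro ⟨hx, hy⟩
    exact ⟨_, connectedComponentIn_subset U x, isPreconnected_connectedComponentIn,
      mem_connectedComponentIn hx, hy⟩

theorem eventually_linked [LocallyConnectedSpace α] (hU : IsOpen U) (hz : z ∈ U) :
    ∀ᶠ w in 𝓝 z, Linked U z w := by
  filter_upwards [hU.connectedComponentIn.mem_nhds (mem_connectedComponentIn hz)] with w hw
  exact linked_iff_mem_connectedComponentIn.2 ⟨hz, hw⟩

open scoped Classical in
theorem continuousOn_linked_indicator [LocallyConnectedSpace α] (hU : IsOpen U) (x : α) :
    ContinuousOn (fun z => if Linked U x z then (1 : ℤ) else 0) U := by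
  intro z hz
  refine ContinuousAt.continuousWithinAt <|
    (continuousAt_const (y := if Linked U x z then (1 : ℤ) else 0)).congr ?_
  filter_upwards [eventually_linked hU hz] with w hw
  have hiff : Linked U x z ↔ Linked U x w := ⟨fun h => h.trans hw, fun h => h.trans hw.symm⟩
  simp only [hiff]

end Components

section Annulus

variable {E : Type*} [NormedAddCommGroup E] [NormedSpace ℝ E]

theorem isPreconnected_setOf_norm_sub_mem (h : 1 < Module.rank ℝ E) {I : Set ℝ}
    (hI : IsPreconnected I) (hpos : I ⊆ Ioi 0) (x : E) : IsPreconnected {z | ‖z - x‖ ∈ I} := by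
  have himage : {z | ‖z - x‖ ∈ I} =
      (fun p : ℝ × E => x + p.1 • p.2) '' (I ×ˢ Metric.sphere 0 1) := by
    ext z
    constructor
    · intro hz
      have hne : ‖z - x‖ ≠ 0 := (hpos hz).ne'
      refine ⟨(‖z - x‖, ‖z - x‖⁻¹ • (z - x)), ⟨hz, ?_⟩, ?_⟩
      · simp [norm_smul, hne]
      · simp [smul_smul, hne]
    · rintro ⟨⟨t, u⟩, ⟨ht, hu⟩, rfl⟩
      have hu1 : ‖u‖ = 1 := by simpa using hu
      simpa [norm_smul, hu1, abs_of_pos (mem_Ioi.1 (hpos ht))] using ht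
  rw [himage]
  exact (hI.prod (isPreconnected_sphere h 0 1)).image _ (by fun_prop)

theorem isPreconnected_ball_diff_singleton (h : 1 < Module.rank ℝ E) (x : E) (r : ℝ) :
    IsPreconnected (Metric.ball x r \ {x}) := by
  convert isPreconnected_setOf_norm_sub_mem h (isPreconnected_Ioo (a := 0) (b := r))
    (fun t ht => ht.1) x using 1
  ext z
  simp [dist_eq_norm, sub_eq_zero, and_comm]

theorem exists_eventually_eq_cobounded {β : Type*} [TopologicalSpace β] [DiscreteTopology β]
    (h : 1 < Module.rank ℝ E) {Z : Set E} (hZ : IsBounded Z) {c : E → β} (hc : ContinuousOn c Zᶜ) :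
    ∃ k, ∀ᶠ z in cobounded E, c z = k := by
  obtain ⟨R, hR0, hR⟩ := hZ.exists_pos_norm_le
  have hconn : IsPreconnected {z : E | R < ‖z‖} := by
    simpa using isPreconnected_setOf_norm_sub_mem h (isPreconnected_Ioi (a := R))
      (Ioi_subset_Ioi hR0.le) (0 : E)
  have hsub : {z : E | R < ‖z‖} ⊆ Zᶜ := fun z hz hzZ => (hR z hzZ).not_gt hz
  have hev : ∀ᶠ z in cobounded E, R < ‖z‖ := tendsto_norm_cobounded_atTop.eventually_gt_atTop R
  rcases {z : E | R < ‖z‖}.eq_empty_or_nonempty with hempty | ⟨z₀, hz₀⟩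
  · exact ⟨c 0, hev.mono fun z hz => (hempty.subset hz).elim⟩
  · exact ⟨c z₀, hev.mono fun z hz => hconn.constant (hc.mono hsub) hz hz₀⟩

open scoped Classical in
theorem exists_normalized_indicator (h : 1 < Module.rank ℝ E) {Z : Set E} (hZ : IsCompact Z)
    (x : E) : ∃ (c : E → ℤ) (k : ℤ), ContinuousOn c Zᶜ ∧ (∀ᶠ z in cobounded E, c z = 0) ∧
      ∀ z, c z = (if Linked Zᶜ x z then 1 else 0) - k := by
  have hind := continuousOn_linked_indicator hZ.isClosed.isOpen_compl x
  obtain ⟨k, hk⟩ := exists_eventually_eq_cobounded h hZ.isBounded hind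
  exact ⟨_, k, hind.sub continuousOn_const, hk.mono fun z hz => sub_eq_zero.2 hz, fun _ => rfl⟩

end Annulus

section Logarithm

open Complex

theorem eq_of_exp_eq_one {α : Type*} [TopologicalSpace α] {C : Set α} (hC : IsPreconnected C)
    {f : α → ℂ} (hf : ContinuousOn f C) (h : ∀ z ∈ C, exp (f z) = 1) {x y : α}
    (hx : x ∈ C) (hy : y ∈ C) : f x = f y :=
  isCoveringMap_exp.eqOn_of_comp_eqOn hC hf continuousOn_const
    (fun z hz => Subtype.ext ((h z hz).trans (h y hy).symm)) hy rfl hx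

theorem exists_continuous_log {α : Type*} [TopologicalSpace α] [SimplyConnectedSpace α]
    [LocallyPathConnectedSpace α] {h : α → ℂ} (hc : Continuous h) (h0 : ∀ z, h z ≠ 0) :
    ∃ L : α → ℂ, Continuous L ∧ ∀ z, exp (L z) = h z := by
  obtain ⟨a⟩ : Nonempty α := inferInstance
  obtain ⟨L, ⟨-, hL⟩, -⟩ := isCoveringMap_exp.existsUnique_continuousMap_lifts
    (A := α) ⟨fun z => (⟨h z, h0 z⟩ : {z : ℂ // z ≠ 0}), by fun_prop⟩ (a₀ := a)
    (e₀ := log (h a)) (Subtype.ext (exp_log (h0 a)))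
  exact ⟨L, L.continuous, fun z => congrArg Subtype.val (congrFun hL z)⟩

theorem continuousOn_comp_log {α : Type*} [TopologicalSpace α] {M : ℂ → α} (hM : Continuous M)
    (hper : Function.Periodic M (2 * Real.pi * I)) :
    ContinuousOn (fun w => M (log w)) {0}ᶜ := by
  intro w₀ (hw₀ : w₀ ≠ 0)
  -- Near `w₀` the continuous branch `log (w / w₀) + log w₀` differs from `log w` by a period.
  have hbranch : ContinuousAt (fun w => M (log (w / w₀) + log w₀)) w₀ :=
    hM.continuousAt.comp
      (((continuousAt_id.div_const _).clog (by simp [hw₀])).add continuousAt_const)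
  refine (hbranch.congr ?_).continuousWithinAt
  filter_upwards [isOpen_compl_singleton.mem_nhds hw₀] with w (hw : w ≠ 0)
  have hexp : exp (log (w / w₀) + log w₀) = exp (log w) := by
    rw [exp_add, exp_log hw₀, exp_log hw, exp_log (div_ne_zero hw hw₀), div_mul_cancel₀ w hw₀]
  obtain ⟨n, hn⟩ := exp_eq_exp_iff_exists_int.1 hexp
  rw [hn]
  exact hper.int_mul n _

theorem tendsto_add_mul_inv_sub_cobounded (b w₀ : ℂ) {c : ℂ} (hc : c ≠ 0) :
    Tendsto (fun w => b + c * (w - w₀)⁻¹) (𝓝[≠] w₀) (cobounded ℂ) := by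
  have hsub : Tendsto (fun w => w - w₀) (𝓝[≠] w₀) (𝓝[≠] 0) := by
    refine tendsto_nhdsWithin_iff.2 ⟨?_, ?_⟩
    · exact ((continuous_id.sub continuous_const).tendsto' w₀ 0 (sub_self w₀)).mono_left
        nhdsWithin_le_nhds
    · filter_upwards [self_mem_nhdsWithin] with w hw using sub_ne_zero.2 hw
  exact (tendsto_const_add_cobounded b).comp
    ((tendsto_mul_left_cobounded hc).comp (tendsto_inv₀_nhdsNE_zero.comp hsub))

theorem continuousOn_update_comp_of_tendsto_cobounded {α β : Type*} [TopologicalSpace α] [T1Space α]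
    [DecidableEq α] [TopologicalSpace β] [Bornology β] {γ : Type*} [TopologicalSpace γ] {g : β → γ}
    {T : α → β} {U : Set β} {W : Set α} {w₀ : α} {k : γ} (hg : ContinuousOn g U)
    (hk : ∀ᶠ z in cobounded β, g z = k) (hT : ContinuousOn T (W \ {w₀}))
    (hmaps : MapsTo T (W \ {w₀}) U) (hlim : Tendsto T (𝓝[≠] w₀) (cobounded β)) :
    ContinuousOn (Function.update (g ∘ T) w₀ k) W := by
  refine continuousOn_update_iff.2 ⟨hg.comp hT hmaps, fun _ => ?_⟩
  refine tendsto_const_nhds.congr' (EventuallyEq.symm ?_)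
  exact (hlim.eventually hk).filter_mono (nhdsWithin_mono _ fun w hw => hw.2)

theorem update_comp_ne_zero {α β : Type*} [DecidableEq α] {g : β → ℂ} (h0 : ∀ z, g z ≠ 0)
    (T : α → β) (w₀ w : α) : Function.update (g ∘ T) w₀ 1 w ≠ 0 := by
  rw [Function.update_apply]
  split_ifs
  exacts [one_ne_zero, h0 _]

theorem exists_log_compl_singleton {g : ℂ → ℂ} {p : ℂ} (hg : ContinuousOn g {p}ᶜ)
    (h0 : ∀ z, g z ≠ 0) (h1 : ∀ᶠ z in cobounded ℂ, g z = 1) :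
    ∃ t : ℂ → ℂ, ContinuousOn t {p}ᶜ ∧ ∀ z ∈ ({p}ᶜ : Set ℂ), exp (t z) = g z := by
  -- The inversion at `p` exchanges `p` and the point at infinity.
  let T : ℂ → ℂ := fun w => p + 1 * (w - 0)⁻¹
  have hh : Continuous (Function.update (g ∘ T) 0 1) := by
    rw [← continuousOn_univ]
    refine continuousOn_update_comp_of_tendsto_cobounded hg h1 ?_ (fun w hw => ?_)
      (tendsto_add_mul_inv_sub_cobounded p 0 one_ne_zero)
    · exact continuousOn_const.add (continuousOn_const.mul
        ((continuousOn_id.sub continuousOn_const).inv₀ fun w hw => by simpa using hw.2))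
    · simpa [T] using hw
  obtain ⟨L, hL, hLe⟩ := exists_continuous_log hh (update_comp_ne_zero h0 T 0)
  refine ⟨fun z => L (z - p)⁻¹, hL.comp_continuousOn ?_, fun z (hz : z ≠ p) => ?_⟩
  · exact ContinuousOn.inv₀ (by fun_prop) fun z hz => sub_ne_zero.2 hz
  · simp [hLe, T, sub_ne_zero.2 hz]

theorem exists_periodic_log {h : ℂ → ℂ} (hc : ContinuousOn h {0}ᶜ) (h0 : ∀ w, h w ≠ 0) :
    ∃ (L : ℂ → ℂ) (m : ℤ), Continuous L ∧
      (∀ ζ, L (ζ + 2 * Real.pi * I) = L ζ + m * (2 * Real.pi * I)) ∧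
      ∀ ζ, exp (L ζ) = h (exp ζ) := by
  have hcomp : Continuous fun ζ => h (exp ζ) :=
    hc.comp_continuous continuous_exp exp_ne_zero
  obtain ⟨L, hL, hLe⟩ := exists_continuous_log hcomp fun ζ => h0 _
  have hone : ∀ ζ, exp (L (ζ + 2 * Real.pi * I) - L ζ) = 1 := by
    intro ζ
    rw [exp_sub, hLe, hLe, exp_periodic]
    exact div_self (h0 _)
  obtain ⟨m, hm⟩ := exp_eq_one_iff.1 (hone 0)
  refine ⟨L, m, hL, fun ζ => ?_, hLe⟩
  have hconst := eq_of_exp_eq_one (f := fun ζ => L (ζ + 2 * Real.pi * I) - L ζ)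
    isPreconnected_univ (by fun_prop) (fun z _ => hone z) (mem_univ ζ) (mem_univ 0)
  rw [hm] at hconst
  linear_combination hconst

/-- The inverse of the Möbius transformation `z ↦ (z - a) / (z - b)`, which moves the points `a` and
`b` to `0` and infinity. Its value at the pole `1` is junk. -/
noncomputable def moebiusInv (a b w : ℂ) : ℂ := b + (b - a) * (w - 1)⁻¹

theorem continuousOn_moebiusInv (a b : ℂ) : ContinuousOn (moebiusInv a b) {1}ᶜ :=
  continuousOn_const.add (continuousOn_const.mul
    ((continuousOn_id.sub continuousOn_const).inv₀ fun _ hw => sub_ne_zero.2 hw))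

theorem div_moebiusInv {a b w : ℂ} (hab : a ≠ b) (hw : w ≠ 1) :
    (moebiusInv a b w - a) / (moebiusInv a b w - b) = w := by
  have hw' : w - 1 ≠ 0 := sub_ne_zero.2 hw
  have hba : b - a ≠ 0 := sub_ne_zero.2 hab.symm
  simp only [moebiusInv, add_sub_cancel_left]
  field_simp
  ring

theorem moebiusInv_div {a b z : ℂ} (hab : a ≠ b) (hz : z ≠ b) :
    moebiusInv a b ((z - a) / (z - b)) = z := by
  have hzb : z - b ≠ 0 := sub_ne_zero.2 hz
  have hba : b - a ≠ 0 := sub_ne_zero.2 hab.symm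
  have hquot : (z - a) / (z - b) - 1 = (b - a) / (z - b) := by
    field_simp
    ring
  rw [moebiusInv, hquot]
  field_simp
  ring

theorem moebiusInv_mem_compl_pair {a b w : ℂ} (hab : a ≠ b) (hw0 : w ≠ 0) (hw1 : w ≠ 1) :
    moebiusInv a b w ∈ ({a, b}ᶜ : Set ℂ) := by
  refine fun h => hw0 ?_
  rw [← div_moebiusInv hab hw1, div_eq_zero_iff, sub_eq_zero, sub_eq_zero]
  exact h

theorem exists_periodic_log_compl_pair {g : ℂ → ℂ} {a b : ℂ} (hab : a ≠ b)
    (hg : ContinuousOn g {a, b}ᶜ) (h0 : ∀ z, g z ≠ 0) (h1 : ∀ᶠ z in cobounded ℂ, g z = 1) :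
    ∃ (L : ℂ → ℂ) (m : ℤ), Continuous L ∧
      (∀ ζ, L (ζ + 2 * Real.pi * I) = L ζ + m * (2 * Real.pi * I)) ∧
      ∀ ζ, ∀ z ∈ ({a, b}ᶜ : Set ℂ), exp ζ = (z - a) / (z - b) → exp (L ζ) = g z := by
  have hba : b - a ≠ 0 := sub_ne_zero.2 hab.symm
  obtain ⟨L, m, hL, hper, hLe⟩ := exists_periodic_log
    (continuousOn_update_comp_of_tendsto_cobounded hg h1
      ((continuousOn_moebiusInv a b).mono fun w hw => hw.2)
      (fun w hw => moebiusInv_mem_compl_pair hab hw.1 hw.2)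
      (tendsto_add_mul_inv_sub_cobounded b 1 hba)) (update_comp_ne_zero h0 (moebiusInv a b) 1)
  refine ⟨L, m, hL, hper, fun ζ z hz hζ => ?_⟩
  have hzb : z ≠ b := fun h => hz (Or.inr h)
  have hne : (z - a) / (z - b) ≠ 1 := by
    rw [ne_eq, div_eq_one_iff_eq (sub_ne_zero.2 hzb)]
    exact fun h => hba (by linear_combination h)
  rw [hLe, hζ, Function.update_of_ne hne, Function.comp_apply, moebiusInv_div hab hzb]

theorem exists_log_zpow_mul_zpow_compl_pair {g₁ g₂ : ℂ → ℂ} {a b : ℂ} (hab : a ≠ b)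
    (hg₁ : ContinuousOn g₁ {a, b}ᶜ) (h₁ : ∀ z, g₁ z ≠ 0)
    (hg₂ : ContinuousOn g₂ {a, b}ᶜ) (h₂ : ∀ z, g₂ z ≠ 0)
    (h₁' : ∀ᶠ z in cobounded ℂ, g₁ z = 1) (h₂' : ∀ᶠ z in cobounded ℂ, g₂ z = 1) :
    ∃ (p q : ℤ) (t : ℂ → ℂ), ¬ (p = 0 ∧ q = 0) ∧ ContinuousOn t {a, b}ᶜ ∧
      ∀ z ∈ ({a, b}ᶜ : Set ℂ), exp (t z) = g₁ z ^ p * g₂ z ^ q := by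
  obtain ⟨L₁, m₁, hL₁, hper₁, he₁⟩ := exists_periodic_log_compl_pair hab hg₁ h₁ h₁'
  obtain ⟨L₂, m₂, hL₂, hper₂, he₂⟩ := exists_periodic_log_compl_pair hab hg₂ h₂ h₂'
  -- The winding numbers `m₁`, `m₂` satisfy a nontrivial linear relation.
  obtain ⟨p, q, hpq, hm⟩ : ∃ p q : ℤ, ¬ (p = 0 ∧ q = 0) ∧ p * m₁ + q * m₂ = 0 := by
    by_cases h : m₁ = 0 ∧ m₂ = 0
    · exact ⟨1, 0, by simp, by simp [h]⟩
    · exact ⟨m₂, -m₁, by simpa [and_comm] using h, by ring⟩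
  have hm' : (p * m₁ + q * m₂ : ℂ) = 0 := by exact_mod_cast hm
  let M : ℂ → ℂ := fun ζ => p * L₁ ζ + q * L₂ ζ
  have hper : Function.Periodic M (2 * Real.pi * I) := by
    intro ζ
    simp only [M, hper₁, hper₂]
    linear_combination (2 * Real.pi * I) * hm'
  have hsub : ∀ z ∈ ({a, b}ᶜ : Set ℂ), z - a ≠ 0 ∧ z - b ≠ 0 := fun z hz =>
    ⟨sub_ne_zero.2 fun h => hz (Or.inl h), sub_ne_zero.2 fun h => hz (Or.inr h)⟩
  refine ⟨p, q, fun z => M (log ((z - a) / (z - b))), hpq, ?_, fun z hz => ?_⟩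
  · refine (continuousOn_comp_log (by fun_prop) hper).comp (f := fun z => (z - a) / (z - b)) ?_ ?_
    · exact ContinuousOn.div (by fun_prop) (by fun_prop) fun z hz => (hsub z hz).2
    · exact fun z hz => div_ne_zero (hsub z hz).1 (hsub z hz).2
  · have hlog := exp_log (div_ne_zero (hsub z hz).1 (hsub z hz).2)
    simp only [M]
    rw [exp_add, exp_int_mul, exp_int_mul, he₁ _ z hz hlog, he₂ _ z hz hlog]

theorem not_exists_log_compl_pair {a b : ℂ} (hab : a ≠ b) {L : ℂ → ℂ}
    (hL : ContinuousOn L {a, b}ᶜ)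
    (h : ∀ z ∈ ({a, b}ᶜ : Set ℂ), exp (L z) = (z - a) / (z - b)) : False := by
  let S : Set ℂ := {ζ : ℂ | 0 < ζ.re}
  let T : ℂ → ℂ := fun ζ => moebiusInv a b (exp ζ)
  have hne : ∀ ζ ∈ S, exp ζ ≠ 1 := by
    intro ζ (hζ : 0 < ζ.re) h
    have hnorm : Real.exp ζ.re = 1 := by rw [← norm_exp, h, norm_one]
    exact hζ.ne' (Real.exp_eq_one_iff _ |>.1 hnorm)
  have hmaps : MapsTo T S {a, b}ᶜ := fun ζ hζ =>
    moebiusInv_mem_compl_pair hab (exp_ne_zero ζ) (hne ζ hζ)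
  have hT : ContinuousOn T S :=
    (continuousOn_moebiusInv a b).comp continuous_exp.continuousOn hne
  -- `L ∘ T` and the identity are logarithms of `exp`, but only `L ∘ T` is `2πi`-periodic.
  have hconst := eq_of_exp_eq_one (convex_halfSpace_re_gt 0).isPreconnected
    (f := fun ζ => L (T ζ) - ζ) ((hL.comp hT hmaps).sub continuousOn_id)
    (fun ζ hζ => by
      rw [exp_sub, h _ (hmaps hζ), div_moebiusInv hab (hne ζ hζ), div_self (exp_ne_zero ζ)])
    (x := 1) (y := 1 + 2 * Real.pi * I) (by simp) (by simp)
  have hper : T (1 + 2 * Real.pi * I) = T 1 := by simp only [T, exp_periodic (1 : ℂ)]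
  rw [hper] at hconst
  exact two_pi_I_ne_zero (by linear_combination hconst)

theorem exists_log_div_of_path {K : Set ℂ} {p q : ℂ} (h : JoinedIn K p q) :
    ∃ L : ℂ → ℂ, ContinuousOn L Kᶜ ∧ ∀ z ∈ Kᶜ, exp (L z) = (z - p) / (z - q) := by
  classical
  let σ := h.somePath
  have hne : ∀ (t : unitInterval) (z : (Kᶜ : Set ℂ)), (z : ℂ) - σ t ≠ 0 := fun t z hz =>
    z.2 (sub_eq_zero.1 hz ▸ h.somePath_mem t)
  -- Moving the pole along the path from `p` to `q` is a homotopy that starts at the constant `1`.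
  let H : C(unitInterval × (Kᶜ : Set ℂ), {z : ℂ // z ≠ 0}) :=
    ⟨fun x => ⟨((x.2 : ℂ) - σ 0) / ((x.2 : ℂ) - σ x.1), div_ne_zero (hne _ _) (hne _ _)⟩,
      (Continuous.div (by fun_prop) (by fun_prop) fun x => hne _ _).subtype_mk _⟩
  have hH0 : ∀ z, H (0, z) =
      ⟨exp ((ContinuousMap.const (Kᶜ : Set ℂ) (0 : ℂ)) z), exp_ne_zero _⟩ := fun z =>
    Subtype.ext (by simpa [H] using div_self (hne 0 z))
  let F := isCoveringMap_exp.liftHomotopy H (ContinuousMap.const _ 0) hH0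
  have hF := isCoveringMap_exp.liftHomotopy_lifts H (ContinuousMap.const _ 0) hH0
  refine ⟨fun z => if hz : z ∈ Kᶜ then F (1, ⟨z, hz⟩) else 0, ?_, fun z hz => ?_⟩
  · rw [continuousOn_iff_continuous_domRestrict]
    convert (by fun_prop : Continuous fun z : (Kᶜ : Set ℂ) => F (1, z)) using 2 with z
    rw [domRestrict_apply, dif_pos z.2]
  · simp only [hz, dif_pos]
    exact (congrArg Subtype.val (congrFun hF (1, ⟨z, hz⟩))).trans (by simp [H])

end Logarithm

section Coboundary

variable {α : Type*}

/-- `ρ` separates the closed sets `X` and `Y` away from their intersection: it is continuous there,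
with value `1` near every other point of `X` and value `0` near every other point of `Y`. -/
structure IsSeparatingFunction [TopologicalSpace α] (X Y : Set α) (ρ : α → ℝ) : Prop where
  continuousOn : ContinuousOn ρ (X ∩ Y)ᶜ
  eventually_eq_one : ∀ z ∈ X \ Y, ∀ᶠ w in 𝓝 z, ρ w = 1
  eventually_eq_zero : ∀ z ∈ Y \ X, ∀ᶠ w in 𝓝 z, ρ w = 0

theorem exists_isSeparatingFunction [PseudoMetricSpace α] {X Y : Set α} (hX : IsClosed X)
    (hY : IsClosed Y) (hX0 : X.Nonempty) (hY0 : Y.Nonempty) :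
    ∃ ρ : α → ℝ, IsSeparatingFunction X Y ρ := by
  let r : α → ℝ := fun z => Metric.infDist z Y / (Metric.infDist z X + Metric.infDist z Y)
  have hr : ContinuousOn r (X ∩ Y)ᶜ := by
    refine ContinuousOn.div (Metric.continuous_infDist_pt Y).continuousOn
      ((Metric.continuous_infDist_pt X).add (Metric.continuous_infDist_pt Y)).continuousOn ?_
    intro z hz h
    have hdX := Metric.infDist_nonneg (x := z) (s := X)
    have hdY := Metric.infDist_nonneg (x := z) (s := Y)
    exact hz ⟨(hX.mem_iff_infDist_zero hX0).2 (by linarith),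
      (hY.mem_iff_infDist_zero hY0).2 (by linarith)⟩
  have hrat : ∀ z ∉ X ∩ Y, ContinuousAt r z := fun z hz =>
    hr.continuousAt ((hX.inter hY).isOpen_compl.mem_nhds hz)
  refine ⟨fun z => max 0 (min 1 (3 * r z - 1)), by fun_prop, fun z hz => ?_, fun z hz => ?_⟩
  · have hdY : Metric.infDist z Y ≠ 0 := fun h => hz.2 ((hY.mem_iff_infDist_zero hY0).2 h)
    have hrz : r z = 1 := by simp [r, (hX.mem_iff_infDist_zero hX0).1 hz.1, hdY]
    filter_upwards [(hrat z fun h => hz.2 h.2).eventually_const_lt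
      (show (2 / 3 : ℝ) < r z by rw [hrz]; norm_num)] with w hw
    rw [min_eq_left (by linarith), max_eq_right zero_le_one]
  · have hrz : r z = 0 := by simp [r, (hY.mem_iff_infDist_zero hY0).1 hz.1]
    filter_upwards [(hrat z fun h => hz.2 h.1).eventually_lt_const
      (show r z < (1 / 3 : ℝ) by rw [hrz]; norm_num)] with w hw
    exact max_eq_left ((min_le_right _ _).trans (by linarith))

/-- The Mayer-Vietoris coboundary of an integer valued function `c` with respect to a separating
function `ρ`, written multiplicatively: where `ρ` is an integer, it equals `1`. -/
noncomputable def coboundary (c : α → ℤ) (ρ : α → ℝ) (z : α) : ℂ :=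
  Complex.exp (2 * Real.pi * Complex.I * (c z * ρ z))

theorem coboundary_ne_zero (c : α → ℤ) (ρ : α → ℝ) (z : α) : coboundary c ρ z ≠ 0 :=
  Complex.exp_ne_zero _

theorem coboundary_eq_one {c : α → ℤ} (ρ : α → ℝ) {z : α} (hz : c z = 0) :
    coboundary c ρ z = 1 := by
  simp [coboundary, hz]

theorem coboundary_zpow_mul_coboundary_zpow (c₁ c₂ : α → ℤ) (ρ : α → ℝ) (p q : ℤ) (z : α) :
    coboundary c₁ ρ z ^ p * coboundary c₂ ρ z ^ q =
      coboundary (fun z => p * c₁ z + q * c₂ z) ρ z := by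
  simp only [coboundary, ← Complex.exp_int_mul, ← Complex.exp_add]
  push_cast
  ring_nf

theorem coboundary_eq_exp_sub (c : α → ℤ) (ρ : α → ℝ) (κ : ℤ) (z : α) :
    coboundary c ρ z = Complex.exp (2 * Real.pi * Complex.I * (c z * (ρ z - κ) : ℝ)) := by
  refine Complex.exp_eq_exp_iff_exists_int.2 ⟨c z * κ, ?_⟩
  push_cast
  ring

variable [TopologicalSpace α] {X Y Z S : Set α} {c : α → ℤ} {ρ : α → ℝ} {t : α → ℂ}

theorem continuousOn_mul_sub_of_eventually_eq (hZ : IsClosed Z) (hc : ContinuousOn c Zᶜ)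
    (hρ : ContinuousOn ρ Zᶜ) {κ : ℝ} (hκ : ∀ z ∈ Z \ S, ∀ᶠ w in 𝓝 z, ρ w = κ) :
    ContinuousOn (fun z => c z * (ρ z - κ)) Sᶜ := by
  intro z hz
  apply ContinuousAt.continuousWithinAt
  by_cases hzZ : z ∈ Z
  · refine (continuousAt_const (y := (0 : ℝ))).congr ?_
    filter_upwards [hκ z ⟨hzZ, hz⟩] with w hw
    rw [hw, sub_self, mul_zero]
  · have hcz : ContinuousAt (fun w => (c w : ℝ)) z :=
      continuous_of_discreteTopology.continuousAt.comp
        (hc.continuousAt (hZ.isOpen_compl.mem_nhds hzZ))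
    exact hcz.mul ((hρ.continuousAt (hZ.isOpen_compl.mem_nhds hzZ)).sub continuousAt_const)

theorem IsSeparatingFunction.continuousOn_mul_left (hρ : IsSeparatingFunction X Y ρ)
    (hX : IsClosed X) (hY : IsClosed Y) (hc : ContinuousOn c (X ∪ Y)ᶜ) :
    ContinuousOn (fun z => c z * (ρ z - (0 : ℤ))) Xᶜ := by
  refine continuousOn_mul_sub_of_eventually_eq (hX.union hY) hc
    (hρ.continuousOn.mono (compl_subset_compl.2 fun z hz => Or.inl hz.1)) ?_
  rintro z ⟨hz, hzX⟩
  simpa using hρ.eventually_eq_zero z ⟨hz.resolve_left hzX, hzX⟩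

theorem IsSeparatingFunction.continuousOn_mul_right (hρ : IsSeparatingFunction X Y ρ)
    (hX : IsClosed X) (hY : IsClosed Y) (hc : ContinuousOn c (X ∪ Y)ᶜ) :
    ContinuousOn (fun z => c z * (ρ z - (1 : ℤ))) Yᶜ := by
  refine continuousOn_mul_sub_of_eventually_eq (hX.union hY) hc
    (hρ.continuousOn.mono (compl_subset_compl.2 fun z hz => Or.inl hz.1)) ?_
  rintro z ⟨hz, hzY⟩
  simpa using hρ.eventually_eq_one z ⟨hz.resolve_right hzY, hzY⟩

theorem continuousOn_coboundary_of_mul_sub {κ : ℤ}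
    (h : ContinuousOn (fun z => c z * (ρ z - κ)) S) : ContinuousOn (coboundary c ρ) S := by
  rw [funext (coboundary_eq_exp_sub c ρ κ)]
  exact (continuousOn_const.mul (Complex.continuous_ofReal.comp_continuousOn h)).cexp

theorem IsSeparatingFunction.continuousOn_coboundary (hρ : IsSeparatingFunction X Y ρ)
    (hX : IsClosed X) (hY : IsClosed Y) (hc : ContinuousOn c (X ∪ Y)ᶜ) :
    ContinuousOn (coboundary c ρ) (X ∩ Y)ᶜ := by
  rw [compl_inter]
  exact (continuousOn_coboundary_of_mul_sub (hρ.continuousOn_mul_left hX hY hc)).union_of_isOpen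
    (continuousOn_coboundary_of_mul_sub (hρ.continuousOn_mul_right hX hY hc))
    hX.isOpen_compl hY.isOpen_compl

theorem sub_log_eq_of_linked {κ : ℤ} (h : ContinuousOn (fun z => c z * (ρ z - κ)) S)
    (ht : ContinuousOn t S) (hexp : ∀ z ∈ S, Complex.exp (t z) = coboundary c ρ z) {x y : α}
    (hxy : Linked S x y) :
    2 * Real.pi * Complex.I * (c x * (ρ x - κ) : ℝ) - t x =
      2 * Real.pi * Complex.I * (c y * (ρ y - κ) : ℝ) - t y := by
  obtain ⟨C, hCS, hC, hx, hy⟩ := hxy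
  refine eq_of_exp_eq_one hC (f := fun z => 2 * Real.pi * Complex.I * (c z * (ρ z - κ) : ℝ) - t z)
    (ContinuousOn.mono ?_ hCS) (fun z hz => ?_) hx hy
  · exact (continuousOn_const.mul (Complex.continuous_ofReal.comp_continuousOn h)).sub ht
  · rw [Complex.exp_sub, hexp z (hCS hz), ← coboundary_eq_exp_sub]
    exact div_self (coboundary_ne_zero c ρ z)

theorem IsSeparatingFunction.eq_of_exp_eq_coboundary (hρ : IsSeparatingFunction X Y ρ)
    (hX : IsClosed X) (hY : IsClosed Y) (hc : ContinuousOn c (X ∪ Y)ᶜ)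
    (ht : ContinuousOn t (X ∩ Y)ᶜ) (hexp : ∀ z ∈ (X ∩ Y)ᶜ, Complex.exp (t z) = coboundary c ρ z)
    {x y : α} (hxy : Linked Xᶜ x y) (hxy' : Linked Yᶜ x y) : c x = c y := by
  have hXsub : Xᶜ ⊆ (X ∩ Y)ᶜ := compl_subset_compl.2 inter_subset_left
  have hYsub : Yᶜ ⊆ (X ∩ Y)ᶜ := compl_subset_compl.2 inter_subset_right
  have h0 := sub_log_eq_of_linked (hρ.continuousOn_mul_left hX hY hc) (ht.mono hXsub)
    (fun z hz => hexp z (hXsub hz)) hxy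
  have h1 := sub_log_eq_of_linked (hρ.continuousOn_mul_right hX hY hc) (ht.mono hYsub)
    (fun z hz => hexp z (hYsub hz)) hxy'
  have hsub : (2 * Real.pi * Complex.I : ℂ) * c x = 2 * Real.pi * Complex.I * c y := by
    push_cast at h0 h1
    linear_combination h0 - h1
  exact_mod_cast mul_left_cancel₀ Complex.two_pi_I_ne_zero hsub

end Coboundary

section Janiszewski

variable {X Y : Set ℂ}

theorem one_lt_rank_real_complex : 1 < Module.rank ℝ ℂ := by
  rw [Complex.rank_real_complex]
  exact Nat.one_lt_ofNat

theorem Linked.refl_union {x y : ℂ} (h : Linked Xᶜ x y) (h' : Linked Yᶜ x y) :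
    Linked (X ∪ Y)ᶜ x x :=
  Linked.refl (by rw [compl_union]; exact ⟨h.left_mem, h'.left_mem⟩)

theorem linked_compl_union_of_inter_eq_singleton (hX : IsCompact X) (hY : IsCompact Y) {p : ℂ}
    (hXY : X ∩ Y = {p}) {x y : ℂ} (h : Linked Xᶜ x y) (h' : Linked Yᶜ x y) :
    Linked (X ∪ Y)ᶜ x y := by
  by_contra hn
  have hp : p ∈ X ∩ Y := hXY ▸ mem_singleton p
  obtain ⟨c, k, hc, hc0, hcx⟩ :=
    exists_normalized_indicator one_lt_rank_real_complex (hX.union hY) x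
  obtain ⟨ρ, hρ⟩ := exists_isSeparatingFunction hX.isClosed hY.isClosed ⟨p, hp.1⟩ ⟨p, hp.2⟩
  have hg := hρ.continuousOn_coboundary hX.isClosed hY.isClosed hc
  rw [hXY] at hg
  obtain ⟨t, ht, hexp⟩ := exists_log_compl_singleton hg (coboundary_ne_zero c ρ)
    (hc0.mono fun z hz => coboundary_eq_one ρ hz)
  rw [← hXY] at ht hexp
  have heq := hρ.eq_of_exp_eq_coboundary hX.isClosed hY.isClosed hc ht hexp h h'
  simp only [hcx, hn, h.refl_union h', if_true, if_false] at heq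
  lia

theorem linked_compl_union_of_inter_eq_pair (hX : IsCompact X) (hY : IsCompact Y) {a b : ℂ}
    (hab : a ≠ b) (hXY : X ∩ Y = {a, b}) {x y z : ℂ} (hy : Linked Xᶜ x y) (hy' : Linked Yᶜ x y)
    (hz : Linked Xᶜ x z) (hz' : Linked Yᶜ x z) :
    Linked (X ∪ Y)ᶜ x y ∨ Linked (X ∪ Y)ᶜ x z ∨ Linked (X ∪ Y)ᶜ y z := by
  by_contra! ⟨hnxy, hnxz, hnyz⟩
  have ha : a ∈ X ∩ Y := hXY ▸ mem_insert a {b}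
  obtain ⟨c₁, k₁, hc₁, hc₁0, hcx⟩ :=
    exists_normalized_indicator one_lt_rank_real_complex (hX.union hY) x
  obtain ⟨c₂, k₂, hc₂, hc₂0, hcy⟩ :=
    exists_normalized_indicator one_lt_rank_real_complex (hX.union hY) y
  obtain ⟨ρ, hρ⟩ := exists_isSeparatingFunction hX.isClosed hY.isClosed ⟨a, ha.1⟩ ⟨a, ha.2⟩
  have hg₁ := hρ.continuousOn_coboundary hX.isClosed hY.isClosed hc₁
  have hg₂ := hρ.continuousOn_coboundary hX.isClosed hY.isClosed hc₂
  rw [hXY] at hg₁ hg₂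
  -- Some combination of the two coboundaries has a logarithm on the complement of two points.
  obtain ⟨p, q, t, hpq, ht, hexp⟩ := exists_log_zpow_mul_zpow_compl_pair hab
    hg₁ (coboundary_ne_zero c₁ ρ) hg₂ (coboundary_ne_zero c₂ ρ)
    (hc₁0.mono fun z hz => coboundary_eq_one ρ hz) (hc₂0.mono fun z hz => coboundary_eq_one ρ hz)
  simp only [← hXY, coboundary_zpow_mul_coboundary_zpow] at ht hexp
  have hc : ContinuousOn (fun z => p * c₁ z + q * c₂ z) (X ∪ Y)ᶜ :=
    (continuousOn_const.mul hc₁).add (continuousOn_const.mul hc₂)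
  have hxy := hρ.eq_of_exp_eq_coboundary hX.isClosed hY.isClosed hc ht hexp hy hy'
  have hxz := hρ.eq_of_exp_eq_coboundary hX.isClosed hY.isClosed hc ht hexp hz hz'
  simp only [hcx, hcy, hnxy, hnxz, hnyz, hy.refl_union hy', hy.symm.refl_union hy'.symm,
    mt Linked.symm hnxy, if_true, if_false] at hxy hxz
  have hp : p = 0 := by linarith
  exact hpq ⟨hp, by rw [hp] at hxy; linarith⟩

end Janiszewski

section Arcs

theorem image_Icc_union_image_Icc {α β : Type*} [LinearOrder α] (γ : α → β) {s r t : α}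
    (hsr : s ≤ r) (hrt : r ≤ t) : γ '' Icc s r ∪ γ '' Icc r t = γ '' Icc s t := by
  rw [← image_union, Icc_union_Icc_eq_Icc hsr hrt]

theorem image_Icc_inter_image_Icc {α β : Type*} [LinearOrder α] {γ : α → β} {s r t : α}
    (hγ : InjOn γ (Icc s t)) (hsr : s ≤ r) (hrt : r ≤ t) :
    γ '' Icc s r ∩ γ '' Icc r t = {γ r} := by
  rw [← hγ.image_inter (Icc_subset_Icc_right hrt) (Icc_subset_Icc_left hsr),
    Icc_inter_Icc_eq_singleton hsr hrt, image_singleton]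

theorem interior_image_Icc_eq_empty {E : Type*} [NormedAddCommGroup E] [NormedSpace ℝ E]
    (h : 1 < Module.rank ℝ E) {γ : ℝ → E} (hc : Continuous γ) {s t : ℝ}
    (hγ : InjOn γ (Icc s t)) : interior (γ '' Icc s t) = ∅ := by
  have : Nontrivial E := rank_pos_iff_nontrivial.1 (zero_lt_one.trans h)
  have hfin : ({γ s, γ t} : Set E).Finite := (finite_singleton _).insert _
  by_contra! hne
  obtain ⟨x, hxA, hx⟩ := (hfin.countable.dense_compl ℝ).inter_open_nonempty _ isOpen_interior hne
  obtain ⟨r, hr, rfl⟩ := interior_subset hxA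
  simp only [mem_compl_iff, mem_insert_iff, mem_singleton_iff, not_or] at hx
  have hst : Ioo s t ∈ 𝓝 r := Ioo_mem_nhds (hr.1.lt_of_ne fun h => hx.1 (h ▸ rfl))
    (hr.2.lt_of_ne fun h => hx.2 (h ▸ rfl))
  obtain ⟨ε, hε, hball⟩ := Metric.isOpen_iff.1 isOpen_interior _ hxA
  obtain ⟨l, u, ⟨hlr, hru⟩, hlu⟩ := mem_nhds_iff_exists_Ioo_subset.1
    (inter_mem (hc.continuousAt.preimage_mem_nhds (Metric.ball_mem_nhds (γ r) hε)) hst)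
  obtain ⟨a, hla, har⟩ := exists_between hlr
  obtain ⟨b, hrb, hbu⟩ := exists_between hru
  obtain ⟨haball, hsa, hat⟩ := hlu ⟨hla, har.trans hru⟩
  obtain ⟨hbball, hsb, hbt⟩ := hlu ⟨hlr.trans hrb, hbu⟩
  -- The two halves of the arc disconnect the punctured ball around `γ r`.
  obtain ⟨z, hz, hz'⟩ := isPreconnected_closed_iff.1 (isPreconnected_ball_diff_singleton h (γ r) ε)
    (γ '' Icc s r) (γ '' Icc r t) (isCompact_Icc.image hc).isClosed
    (isCompact_Icc.image hc).isClosed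
    (by
      rw [image_Icc_union_image_Icc γ hr.1 hr.2]
      exact sdiff_subset.trans (hball.trans interior_subset))
    ⟨γ a, ⟨haball, fun h => har.ne (hγ ⟨hsa.le, hat.le⟩ hr h)⟩, a, ⟨hsa.le, har.le⟩, rfl⟩
    ⟨γ b, ⟨hbball, fun h => hrb.ne' (hγ ⟨hsb.le, hbt.le⟩ hr h)⟩, b, ⟨hrb.le, hbt.le⟩, rfl⟩
  rw [image_Icc_inter_image_Icc hγ hr.1 hr.2] at hz'
  exact hz.2 hz'

theorem mem_connectedComponentIn_of_mem_closure {α : Type*} [TopologicalSpace α]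
    [LocallyConnectedSpace α] {U : Set α} (hU : IsOpen U) {x z : α} (hz : z ∈ U)
    (hzx : z ∈ closure (connectedComponentIn U x)) : z ∈ connectedComponentIn U x := by
  obtain ⟨w, hw, hwx⟩ := mem_closure_iff.1 hzx _ hU.connectedComponentIn
    (mem_connectedComponentIn hz)
  rw [connectedComponentIn_eq hwx, ← connectedComponentIn_eq hw]
  exact mem_connectedComponentIn hz

theorem subset_connectedComponentIn_of_inter_closure_subset {α : Type*} [TopologicalSpace α]
    [LocallyConnectedSpace α] {U C : Set α} (hU : IsOpen U) (hC : IsPreconnected C) {x : α}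
    (hx : x ∈ U) (hxC : x ∈ C) (h : C ∩ closure (connectedComponentIn U x) ⊆ U) :
    C ⊆ connectedComponentIn U x :=
  hC.subset_left_of_subset_union hU.connectedComponentIn isClosed_closure.isOpen_compl
    (disjoint_compl_right.mono_left subset_closure)
    (fun _ hq => or_iff_not_imp_right.2 fun hqF =>
      mem_connectedComponentIn_of_mem_closure hU (h ⟨hq, not_not.1 hqF⟩) (not_not.1 hqF))
    ⟨x, hxC, mem_connectedComponentIn hx⟩

variable {K : Set ℂ} {γ : ℝ → ℂ} {x y : ℂ} {s t : ℝ}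

theorem linked_compl_image_Icc (hc : Continuous γ) (hst : s ≤ t) (hγ : InjOn γ (Icc s t))
    (hx : x ∉ γ '' Icc s t) (hy : y ∉ γ '' Icc s t) : Linked (γ '' Icc s t)ᶜ x y := by
  have hjoin : ∀ r : Icc s t, JoinedIn {γ r}ᶜ x y := fun r =>
    (isPathConnected_compl_singleton_of_one_lt_rank one_lt_rank_real_complex (γ r)).joinedIn
      x (fun h => hx ⟨r, r.2, h.symm⟩) y (fun h => hy ⟨r, r.2, h.symm⟩)
  let C : Icc s t → Set ℂ := fun r => range (hjoin r).somePath
  have hCopen : ∀ r, IsOpen ((fun u : Icc s t => γ u) ⁻¹' (C r)ᶜ) := fun r =>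
    (isCompact_range (hjoin r).somePath.continuous).isClosed.isOpen_compl.preimage
      (hc.comp continuous_subtype_val)
  -- Cut the arc into pieces each of which is avoided by some path from `x` to `y`.
  obtain ⟨τ, h0, hmono, ⟨m, hm⟩, hτ⟩ := exists_monotone_Icc_subset_open_cover_Icc hst hCopen
    (fun r _ => mem_iUnion.2 ⟨r, fun ⟨v, hv⟩ => (hjoin r).somePath_mem v hv⟩)
  have hpiece : ∀ n, Linked (γ '' Icc (τ n : ℝ) (τ (n + 1)))ᶜ x y := fun n => by
    obtain ⟨r, hr⟩ := hτ n
    refine ⟨C r, ?_, isPreconnected_range (hjoin r).somePath.continuous,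
      ⟨0, (hjoin r).somePath.source⟩, ⟨1, (hjoin r).somePath.target⟩⟩
    rintro _ hz ⟨u, hu, rfl⟩
    exact hr (show ⟨u, (τ n).2.1.trans hu.1, hu.2.trans (τ (n + 1)).2.2⟩ ∈ Icc (τ n) (τ (n + 1))
      from hu) hz
  have hinit : ∀ n, Linked (γ '' Icc s (τ n))ᶜ x y := by
    intro n
    have hn : ∀ n, (τ n : ℝ) ≤ τ (n + 1) := fun n => hmono n.le_succ
    induction n with
    | zero =>
      refine (hpiece 0).mono (compl_subset_compl.2 (image_mono ?_))
      simpa only [h0, Icc_self, singleton_subset_iff, left_mem_Icc] using hn 0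
    | succ n ih =>
      rw [← image_Icc_union_image_Icc γ (τ n).2.1 (hn n)]
      exact linked_compl_union_of_inter_eq_singleton (isCompact_Icc.image hc)
        (isCompact_Icc.image hc) (image_Icc_inter_image_Icc
          (hγ.mono (Icc_subset_Icc_right (τ (n + 1)).2.2)) (τ n).2.1 (hn n)) ih (hpiece n)
  simpa only [hm m le_rfl] using hinit m

theorem linked_compl_union_image_Icc (hK : IsCompact K) (hc : Continuous γ) (hst : s ≤ t)
    (hγ : InjOn γ (Icc s t)) {p : ℂ} (hKγ : K ∩ γ '' Icc s t = {p}) (hxy : Linked Kᶜ x y)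
    (hx : x ∉ γ '' Icc s t) (hy : y ∉ γ '' Icc s t) : Linked (K ∪ γ '' Icc s t)ᶜ x y :=
  linked_compl_union_of_inter_eq_singleton hK (isCompact_Icc.image hc) hKγ hxy
    (linked_compl_image_Icc hc hst hγ hx hy)

theorem exists_log_sub_log_ne {a b : ℂ} (hab : a ≠ b) {U W : Set ℂ} (hU : IsOpen U)
    (hW : IsOpen W) (hUW : {a, b}ᶜ ⊆ U ∪ W) {L M : ℂ → ℂ} (hL : ContinuousOn L U)
    (hM : ContinuousOn M W) (hLexp : ∀ z ∈ U, Complex.exp (L z) = (z - a) / (z - b))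
    (hMexp : ∀ z ∈ W, Complex.exp (M z) = (z - a) / (z - b)) {κ : ℂ} (hκ : Complex.exp κ = 1) :
    ∃ z ∈ U ∩ W, L z - M z ≠ κ := by
  classical
  by_contra! hcon
  have hpw : EqOn (U.piecewise L fun z => M z + κ) (fun z => M z + κ) W := by
    intro z hz
    by_cases hzU : z ∈ U
    · rw [piecewise_eq_of_mem _ _ _ hzU]
      exact sub_eq_iff_eq_add'.1 (hcon z ⟨hzU, hz⟩)
    · rw [piecewise_eq_of_notMem _ _ _ hzU]
  refine not_exists_log_compl_pair hab (L := U.piecewise L fun z => M z + κ) ?_ fun z hz => ?_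
  · exact ((hL.congr (piecewise_eqOn _ _ _)).union_of_isOpen
      ((hM.add continuousOn_const).congr hpw) hU hW).mono hUW
  · by_cases hzU : z ∈ U
    · rw [piecewise_eq_of_mem _ _ _ hzU, hLexp z hzU]
    · rw [piecewise_eq_of_notMem _ _ _ hzU, Complex.exp_add, hκ, mul_one,
        hMexp z ((hUW hz).resolve_left hzU)]

/-- A crosscut of the complement of `K`: an arc that meets `K` exactly in its two ends. It is how
a new edge sits with respect to the part of a drawing that is already there. -/
structure IsCrosscut (K : Set ℂ) (γ : ℝ → ℂ) : Prop where
  continuous : Continuous γ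
  injOn : InjOn γ (Icc 0 1)
  inter_eq : K ∩ γ '' Icc 0 1 = {γ 0, γ 1}

namespace IsCrosscut

theorem isCompact_image (h : IsCrosscut K γ) : IsCompact (γ '' Icc 0 1) :=
  isCompact_Icc.image h.continuous

theorem ne (h : IsCrosscut K γ) : γ 0 ≠ γ 1 := fun heq =>
  zero_ne_one (h.injOn (by simp) (by simp) heq)

theorem eq_zero_or_eq_one (h : IsCrosscut K γ) (ht : t ∈ Icc (0 : ℝ) 1) (hK : γ t ∈ K) :
    t = 0 ∨ t = 1 :=
  (h.inter_eq.subset ⟨hK, t, ht, rfl⟩).imp (h.injOn ht (by simp)) (h.injOn ht (by simp))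

theorem linked_compl_union_union (h : IsCrosscut K γ) (hK : IsCompact K) (hxy : Linked Kᶜ x y)
    (hx : x ∉ γ '' Icc 0 1) (hy : y ∉ γ '' Icc 0 1) (hs : 0 ≤ s) (hst : s < t) (ht : t ≤ 1) :
    Linked ((K ∪ γ '' Icc 0 s) ∪ γ '' Icc t 1)ᶜ x y := by
  have hs1 : Icc 0 s ⊆ Icc 0 1 := Icc_subset_Icc_right (by linarith)
  have ht1 : Icc t 1 ⊆ Icc 0 1 := Icc_subset_Icc_left (by linarith)
  have h0 : K ∩ γ '' Icc 0 s = {γ 0} := by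
    refine Subset.antisymm ?_ (singleton_subset_iff.2
      ⟨(h.inter_eq.superset (mem_insert _ _)).1, 0, ⟨le_rfl, hs⟩, rfl⟩)
    rintro _ ⟨huK, u, hu, rfl⟩
    obtain rfl | rfl := h.eq_zero_or_eq_one (hs1 hu) huK
    exacts [rfl, absurd hu.2 (by linarith)]
  have h1 : (K ∪ γ '' Icc 0 s) ∩ γ '' Icc t 1 = {γ 1} := by
    refine Subset.antisymm ?_ (singleton_subset_iff.2
      ⟨Or.inl (h.inter_eq.superset (Or.inr rfl)).1, 1, ⟨ht, le_rfl⟩, rfl⟩)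
    rintro _ ⟨huK | ⟨v, hv, hvu⟩, u, hu, rfl⟩
    · obtain rfl | rfl := h.eq_zero_or_eq_one (ht1 hu) huK
      exacts [absurd hu.1 (by linarith), rfl]
    · obtain rfl := h.injOn (hs1 hv) (ht1 hu) hvu
      exact absurd hu.1 (by linarith [hv.2])
  refine linked_compl_union_image_Icc (hK.union (isCompact_Icc.image h.continuous)) h.continuous ht
    (h.injOn.mono ht1) h1 ?_ (fun hmem => hx (image_mono ht1 hmem))
    (fun hmem => hy (image_mono ht1 hmem))
  exact linked_compl_union_image_Icc hK h.continuous hs (h.injOn.mono hs1) h0 hxy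
    (fun hmem => hx (image_mono hs1 hmem)) (fun hmem => hy (image_mono hs1 hmem))

theorem mem_closure_of_not_linked (h : IsCrosscut K γ) (hK : IsCompact K) (hxy : Linked Kᶜ x y)
    (hx : x ∉ γ '' Icc 0 1) (hy : y ∉ γ '' Icc 0 1) (hn : ¬ Linked (K ∪ γ '' Icc 0 1)ᶜ x y)
    {r : ℝ} (hr : r ∈ Ioo 0 1) : γ r ∈ closure (connectedComponentIn (K ∪ γ '' Icc 0 1)ᶜ x) := by
  have hU : IsOpen (K ∪ γ '' Icc 0 1)ᶜ := (hK.union h.isCompact_image).isClosed.isOpen_compl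
  have hxU : x ∈ (K ∪ γ '' Icc 0 1)ᶜ := by
    rw [compl_union]
    exact ⟨hxy.left_mem, hx⟩
  by_contra hcl
  obtain ⟨l, u, ⟨hlr, hru⟩, hlu⟩ := mem_nhds_iff_exists_Ioo_subset.1 (inter_mem
    (h.continuous.continuousAt.preimage_mem_nhds (isClosed_closure.isOpen_compl.mem_nhds hcl))
    (Ioo_mem_nhds hr.1 hr.2))
  obtain ⟨s, hls, hsr⟩ := exists_between hlr
  obtain ⟨t, hrt, htu⟩ := exists_between hru
  obtain ⟨C, hC, hCp, hxC, hyC⟩ := h.linked_compl_union_union hK hxy hx hy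
    (hlu ⟨hls, hsr.trans hru⟩).2.1.le (hsr.trans hrt) (hlu ⟨hlr.trans hrt, htu⟩).2.2.le
  refine hn (linked_iff_mem_connectedComponentIn.2 ⟨hxU,
    subset_connectedComponentIn_of_inter_closure_subset hU hCp hxU hxC ?_ hyC⟩)
  rintro q ⟨hqC, hqcl⟩ (hqK | ⟨v, hv, rfl⟩)
  · exact hC hqC (Or.inl (Or.inl hqK))
  · have hsv : s < v := not_le.1 fun hvs => hC hqC (Or.inl (Or.inr ⟨v, ⟨hv.1, hvs⟩, rfl⟩))
    have hvt : v < t := not_le.1 fun htv => hC hqC (Or.inr ⟨v, ⟨htv, hv.2⟩, rfl⟩)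
    exact (hlu ⟨hls.trans hsv, hvt.trans htu⟩).1 hqcl

theorem image_Ioo_subset (h : IsCrosscut K γ) :
    γ '' Ioo 0 1 ⊆ connectedComponentIn Kᶜ (γ (1 / 2)) := by
  refine (isPreconnected_Ioo.image γ h.continuous.continuousOn).subset_connectedComponentIn
    ⟨1 / 2, by norm_num, rfl⟩ ?_
  rintro _ ⟨t, ht, rfl⟩ htK
  exact (h.eq_zero_or_eq_one (Ioo_subset_Icc_self ht) htK).elim ht.1.ne' ht.2.ne

theorem image_diff_subset (h : IsCrosscut K γ) :
    γ '' Icc 0 1 \ K ⊆ connectedComponentIn Kᶜ (γ (1 / 2)) := by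
  have hends : {γ 0, γ 1} ⊆ K := h.inter_eq.superset.trans inter_subset_left
  rintro _ ⟨⟨t, ht, rfl⟩, htK⟩
  exact h.image_Ioo_subset ⟨t, ⟨ht.1.lt_of_ne fun h0 => htK (hends (Or.inl (h0 ▸ rfl))),
    ht.2.lt_of_ne fun h1 => htK (hends (Or.inr (h1 ▸ rfl)))⟩, rfl⟩

theorem not_subset_image (h : IsCrosscut K γ) {O : Set ℂ} (hO : IsOpen O) (hne : O.Nonempty) :
    ¬ O ⊆ γ '' Icc 0 1 := fun hsub => by
  have hempty := interior_maximal hsub hO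
  rw [interior_image_Icc_eq_empty one_lt_rank_real_complex h.continuous h.injOn] at hempty
  exact hne.ne_empty (subset_empty_iff.1 hempty)

theorem nonempty_component_diff (h : IsCrosscut K γ) (hK : IsClosed K) :
    (connectedComponentIn Kᶜ (γ (1 / 2)) \ γ '' Icc 0 1).Nonempty := by
  rw [sdiff_nonempty]
  exact h.not_subset_image hK.isOpen_compl.connectedComponentIn
    ⟨_, h.image_Ioo_subset ⟨1 / 2, by norm_num, rfl⟩⟩

theorem exists_not_linked_of_joinedIn (h : IsCrosscut K γ) (hK : IsClosed K)
    (hjoin : JoinedIn K (γ 0) (γ 1)) :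
    ∃ x ∈ connectedComponentIn Kᶜ (γ (1 / 2)) \ γ '' Icc 0 1,
      ∃ y ∈ connectedComponentIn Kᶜ (γ (1 / 2)) \ γ '' Icc 0 1,
        ¬ Linked (K ∪ γ '' Icc 0 1)ᶜ x y := by
  have hFK : connectedComponentIn Kᶜ (γ (1 / 2)) ⊆ Kᶜ := connectedComponentIn_subset _ _
  obtain ⟨x, hxF, hxA⟩ := h.nonempty_component_diff hK
  obtain ⟨L, hL, hLexp⟩ := exists_log_div_of_path hjoin
  have hjoin' : JoinedIn (γ '' Icc 0 1) (γ 0) (γ 1) :=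
    JoinedIn.ofLine h.continuous.continuousOn rfl rfl Subset.rfl
  obtain ⟨M, hM, hMexp⟩ := exists_log_div_of_path hjoin'
  have hsub : ∀ z ∈ (K ∪ γ '' Icc 0 1)ᶜ, Complex.exp (L z - M z) = 1 := by
    intro z hz
    rw [compl_union] at hz
    rw [Complex.exp_sub, hLexp z hz.1, ← hMexp z hz.2, div_self (Complex.exp_ne_zero _)]
  have hcover : {γ 0, γ 1}ᶜ ⊆ connectedComponentIn Kᶜ (γ (1 / 2)) ∪ (γ '' Icc 0 1)ᶜ := by
    refine fun z hz => or_iff_not_imp_right.2 fun hzA => h.image_diff_subset ⟨not_not.1 hzA, ?_⟩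
    exact fun hzK => hz (h.inter_eq.subset ⟨hzK, not_not.1 hzA⟩)
  obtain ⟨y, hy, hne⟩ := exists_log_sub_log_ne h.ne hK.isOpen_compl.connectedComponentIn
    h.isCompact_image.isClosed.isOpen_compl hcover (hL.mono hFK) hM
    (fun z hz => hLexp z (hFK hz)) hMexp (κ := L x - M x)
    (hsub x (by rw [compl_union]; exact ⟨hFK hxF, hxA⟩))
  refine ⟨x, ⟨hxF, hxA⟩, y, hy, fun ⟨C, hC, hCp, hxC, hyC⟩ => hne ?_⟩
  rw [compl_union] at hC
  exact eq_of_exp_eq_one hCp (f := fun z => L z - M z)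
    ((hL.mono (hC.trans inter_subset_left)).sub (hM.mono (hC.trans inter_subset_right)))
    (fun z hz => hsub z (by rw [compl_union]; exact hC hz)) hyC hxC

end IsCrosscut

end Arcs

section ComplComponents

variable {α : Type*} [TopologicalSpace α] {K A F F' : Set α} {x : α}

/-- The connected components of the complement of `K`. For the support of a drawing these are its
faces. -/
def complComponents (K : Set α) : Set (Set α) :=
  {F | ∃ x ∈ Kᶜ, F = connectedComponentIn Kᶜ x}

theorem connectedComponentIn_mem_complComponents (hx : x ∉ K) :
    connectedComponentIn Kᶜ x ∈ complComponents K :=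
  ⟨x, hx, rfl⟩

theorem eq_connectedComponentIn_of_mem_complComponents (hF : F ∈ complComponents K) (hx : x ∈ F) :
    F = connectedComponentIn Kᶜ x := by
  obtain ⟨y, -, rfl⟩ := hF
  exact connectedComponentIn_eq hx

theorem eq_of_mem_complComponents (hF : F ∈ complComponents K) (hF' : F' ∈ complComponents K)
    (hx : x ∈ F) (hx' : x ∈ F') : F = F' :=
  (eq_connectedComponentIn_of_mem_complComponents hF hx).trans
    (eq_connectedComponentIn_of_mem_complComponents hF' hx').symm

theorem subset_compl_of_mem_complComponents (hF : F ∈ complComponents K) : F ⊆ Kᶜ := by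
  obtain ⟨y, -, rfl⟩ := hF
  exact connectedComponentIn_subset _ _

theorem isConnected_of_mem_complComponents (hF : F ∈ complComponents K) : IsConnected F := by
  obtain ⟨y, hy, rfl⟩ := hF
  exact isConnected_connectedComponentIn_iff.2 hy

theorem isOpen_of_mem_complComponents [LocallyConnectedSpace α] (hK : IsClosed K)
    (hF : F ∈ complComponents K) : IsOpen F := by
  obtain ⟨y, -, rfl⟩ := hF
  exact hK.isOpen_compl.connectedComponentIn

theorem mem_of_mem_closure_of_mem_complComponents [LocallyConnectedSpace α] (hK : IsClosed K)
    (hF : F ∈ complComponents K) (hx : x ∉ K) (hxF : x ∈ closure F) : x ∈ F := by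
  obtain ⟨y, -, rfl⟩ := hF
  exact mem_connectedComponentIn_of_mem_closure hK.isOpen_compl hx hxF

theorem mem_complComponents_of_frontier_subset (hF : IsConnected F) (hFopen : IsOpen F)
    (hFK : F ⊆ Kᶜ) (hfr : frontier F ⊆ K) : F ∈ complComponents K := by
  obtain ⟨x, hx⟩ := hF.nonempty
  refine ⟨x, hFK hx, Subset.antisymm (hF.isPreconnected.subset_connectedComponentIn hx hFK) ?_⟩
  refine isPreconnected_connectedComponentIn.subset_left_of_subset_union hFopen
    isClosed_closure.isOpen_compl (disjoint_compl_right.mono_left subset_closure)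
    (fun z hz => or_iff_not_imp_right.2 fun hzF => ?_) ⟨x, mem_connectedComponentIn (hFK hx), hx⟩
  by_contra hzF'
  exact connectedComponentIn_subset _ _ hz (hfr (hFopen.frontier_eq ▸ ⟨not_not.1 hzF, hzF'⟩))

theorem connectedComponentIn_compl_union (hx : x ∉ K)
    (hA : Disjoint (connectedComponentIn Kᶜ x) A) :
    connectedComponentIn (K ∪ A)ᶜ x = connectedComponentIn Kᶜ x := by
  refine (connectedComponentIn_mono x (compl_subset_compl.2 subset_union_left)).antisymm ?_
  refine isPreconnected_connectedComponentIn.subset_connectedComponentIn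
    (mem_connectedComponentIn hx) ?_
  rw [compl_union]
  exact subset_inter (connectedComponentIn_subset _ _) hA.subset_compl_right

theorem complComponents_union (hF : F ∈ complComponents K) (hA : A \ K ⊆ F) :
    complComponents (K ∪ A) =
      complComponents K \ {F} ∪ connectedComponentIn (K ∪ A)ᶜ '' (F \ A) := by
  have hmem : ∀ x, x ∈ (K ∪ A)ᶜ ↔ x ∉ K ∧ x ∉ A := fun x => by
    rw [compl_union, mem_inter_iff, mem_compl_iff, mem_compl_iff]
  have hother : ∀ F' ∈ complComponents K, F' ≠ F → Disjoint F' A := fun F' hF' hne =>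
    disjoint_left.2 fun z hz hzA => hne (eq_of_mem_complComponents hF' hF hz
      (hA ⟨hzA, subset_compl_of_mem_complComponents hF' hz⟩))
  apply Subset.antisymm
  · rintro _ ⟨x, hx, rfl⟩
    obtain ⟨hxK, hxA⟩ := (hmem x).1 hx
    by_cases hxF : x ∈ F
    · exact Or.inr ⟨x, ⟨hxF, hxA⟩, rfl⟩
    · have hxK' := connectedComponentIn_mem_complComponents hxK
      have hne : connectedComponentIn Kᶜ x ≠ F := fun h => hxF (h ▸ mem_connectedComponentIn hxK)
      rw [connectedComponentIn_compl_union hxK (hother _ hxK' hne)]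
      exact Or.inl ⟨hxK', hne⟩
  · rintro _ (⟨⟨x, hxK, rfl⟩, hne⟩ | ⟨x, ⟨hxF, hxA⟩, rfl⟩)
    · have hdisj := hother _ (connectedComponentIn_mem_complComponents hxK) hne
      rw [← connectedComponentIn_compl_union hxK hdisj]
      exact connectedComponentIn_mem_complComponents ((hmem x).2
        ⟨hxK, disjoint_left.1 hdisj (mem_connectedComponentIn hxK)⟩)
    · exact connectedComponentIn_mem_complComponents ((hmem x).2
        ⟨subset_compl_of_mem_complComponents hF hxF, hxA⟩)

end ComplComponents

namespace IsCrosscut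

variable {K : Set ℂ} {γ : ℝ → ℂ} {x y : ℂ}

theorem component_mem_complComponents (h : IsCrosscut K γ) :
    connectedComponentIn Kᶜ (γ (1 / 2)) ∈ complComponents K :=
  connectedComponentIn_mem_complComponents
    (connectedComponentIn_subset _ _ (h.image_Ioo_subset ⟨1 / 2, by norm_num, rfl⟩))

theorem complComponents_union (h : IsCrosscut K γ) :
    complComponents (K ∪ γ '' Icc 0 1) =
      complComponents K \ {connectedComponentIn Kᶜ (γ (1 / 2))} ∪
        connectedComponentIn (K ∪ γ '' Icc 0 1)ᶜ ''
          (connectedComponentIn Kᶜ (γ (1 / 2)) \ γ '' Icc 0 1) :=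
  _root_.complComponents_union h.component_mem_complComponents h.image_diff_subset

theorem linked_of_mem (hx : x ∈ connectedComponentIn Kᶜ (γ (1 / 2)))
    (hy : y ∈ connectedComponentIn Kᶜ (γ (1 / 2))) : Linked Kᶜ x y :=
  ⟨_, connectedComponentIn_subset _ _, isPreconnected_connectedComponentIn, hx, hy⟩

theorem mem_compl_union (hx : x ∈ connectedComponentIn Kᶜ (γ (1 / 2)) \ γ '' Icc 0 1) :
    x ∈ (K ∪ γ '' Icc 0 1)ᶜ := by
  rw [compl_union]
  exact ⟨connectedComponentIn_subset _ _ hx.1, hx.2⟩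

theorem image_subset_closure (h : IsCrosscut K γ) (hK : IsCompact K)
    (hx : x ∈ connectedComponentIn Kᶜ (γ (1 / 2)) \ γ '' Icc 0 1) :
    γ '' Icc 0 1 ⊆ closure (connectedComponentIn (K ∪ γ '' Icc 0 1)ᶜ x) := by
  suffices hIoo : γ '' Ioo 0 1 ⊆ closure (connectedComponentIn (K ∪ γ '' Icc 0 1)ᶜ x) by
    have hIcc : γ '' Icc 0 1 ⊆ closure (γ '' Ioo 0 1) := by
      rw [← closure_Ioo (zero_ne_one (α := ℝ))]
      exact image_closure_subset_closure_image h.continuous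
    exact hIcc.trans (closure_minimal hIoo isClosed_closure)
  by_cases hall : connectedComponentIn Kᶜ (γ (1 / 2)) \ γ '' Icc 0 1 ⊆
      connectedComponentIn (K ∪ γ '' Icc 0 1)ᶜ x
  · refine fun z hz => mem_closure_iff.2 fun O hO hzO => ?_
    obtain ⟨w, ⟨hwO, hw⟩, hwA⟩ := not_subset.1 (h.not_subset_image
      (hO.inter hK.isClosed.isOpen_compl.connectedComponentIn) ⟨z, hzO, h.image_Ioo_subset hz⟩)
    exact ⟨w, hwO, hall ⟨hw, hwA⟩⟩
  · obtain ⟨y, hy, hxy⟩ := not_subset.1 hall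
    rintro _ ⟨r, hr, rfl⟩
    exact h.mem_closure_of_not_linked hK (linked_of_mem hx.1 hy.1) hx.2 hy.2
      (fun hl => hxy (linked_iff_mem_connectedComponentIn.1 hl).2) hr

theorem linked_compl_union_of_disjoint {K₁ K₂ : Set ℂ} (h : IsCrosscut (K₁ ∪ K₂) γ)
    (hK₁ : IsCompact K₁) (hK₂ : IsCompact K₂) (hdisj : Disjoint K₁ K₂) (h₁ : γ 0 ∈ K₁)
    (h₂ : γ 1 ∈ K₂) (hxy : Linked (K₁ ∪ K₂)ᶜ x y) (hx : x ∉ γ '' Icc 0 1)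
    (hy : y ∉ γ '' Icc 0 1) : Linked (K₁ ∪ K₂ ∪ γ '' Icc 0 1)ᶜ x y := by
  have hA₁ : K₁ ∩ γ '' Icc 0 1 = {γ 0} := by
    refine Subset.antisymm ?_ (singleton_subset_iff.2 ⟨h₁, 0, by simp, rfl⟩)
    rintro _ ⟨hz, t, ht, rfl⟩
    obtain rfl | rfl := h.eq_zero_or_eq_one ht (Or.inl hz)
    exacts [rfl, absurd h₂ (disjoint_left.1 hdisj hz)]
  have hA₂ : (K₁ ∪ γ '' Icc 0 1) ∩ K₂ = {γ 1} := by
    rw [union_inter_distrib_right, hdisj.inter_eq, empty_union]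
    refine Subset.antisymm ?_ (singleton_subset_iff.2 ⟨⟨1, by simp, rfl⟩, h₂⟩)
    rintro _ ⟨⟨t, ht, rfl⟩, hz⟩
    obtain rfl | rfl := h.eq_zero_or_eq_one ht (Or.inr hz)
    exacts [absurd hz (disjoint_left.1 hdisj h₁), rfl]
  rw [union_right_comm]
  exact linked_compl_union_of_inter_eq_singleton (hK₁.union h.isCompact_image) hK₂ hA₂
    (linked_compl_union_image_Icc hK₁ h.continuous zero_le_one h.injOn hA₁
      (hxy.mono (compl_subset_compl.2 subset_union_left)) hx hy)
    (hxy.mono (compl_subset_compl.2 subset_union_right))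

theorem ncard_image_eq_one_of_disjoint {K₁ K₂ : Set ℂ} (h : IsCrosscut (K₁ ∪ K₂) γ)
    (hK₁ : IsCompact K₁) (hK₂ : IsCompact K₂) (hdisj : Disjoint K₁ K₂) (h₁ : γ 0 ∈ K₁)
    (h₂ : γ 1 ∈ K₂) :
    (connectedComponentIn (K₁ ∪ K₂ ∪ γ '' Icc 0 1)ᶜ ''
      (connectedComponentIn (K₁ ∪ K₂)ᶜ (γ (1 / 2)) \ γ '' Icc 0 1)).ncard = 1 := by
  obtain ⟨x, hx⟩ := h.nonempty_component_diff (hK₁.union hK₂).isClosed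
  refine ncard_eq_one.2 ⟨_, Subset.antisymm ?_ (singleton_subset_iff.2 ⟨x, hx, rfl⟩)⟩
  rintro _ ⟨y, hy, rfl⟩
  have hxy := h.linked_compl_union_of_disjoint hK₁ hK₂ hdisj h₁ h₂ (linked_of_mem hx.1 hy.1)
    hx.2 hy.2
  exact (connectedComponentIn_eq (linked_iff_mem_connectedComponentIn.1 hxy).2).symm

theorem ncard_image_eq_two_of_joinedIn (h : IsCrosscut K γ) (hK : IsCompact K)
    (hjoin : JoinedIn K (γ 0) (γ 1)) :
    (connectedComponentIn (K ∪ γ '' Icc 0 1)ᶜ ''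
      (connectedComponentIn Kᶜ (γ (1 / 2)) \ γ '' Icc 0 1)).ncard = 2 := by
  obtain ⟨x, hx, y, hy, hxy⟩ := h.exists_not_linked_of_joinedIn hK.isClosed hjoin
  have heq : ∀ {z w : ℂ}, Linked (K ∪ γ '' Icc 0 1)ᶜ z w →
      connectedComponentIn (K ∪ γ '' Icc 0 1)ᶜ w = connectedComponentIn (K ∪ γ '' Icc 0 1)ᶜ z :=
    fun hzw => (connectedComponentIn_eq (linked_iff_mem_connectedComponentIn.1 hzw).2).symm
  have hne : connectedComponentIn (K ∪ γ '' Icc 0 1)ᶜ x ≠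
      connectedComponentIn (K ∪ γ '' Icc 0 1)ᶜ y := fun heq' =>
    hxy (linked_iff_mem_connectedComponentIn.2
      ⟨mem_compl_union hx, heq' ▸ mem_connectedComponentIn (mem_compl_union hy)⟩)
  refine ncard_eq_two.2 ⟨_, _, hne, Subset.antisymm ?_ (pair_subset ⟨x, hx, rfl⟩ ⟨y, hy, rfl⟩)⟩
  rintro _ ⟨z, hz, rfl⟩
  have harc : ∀ w ∉ γ '' Icc 0 1, Linked (γ '' Icc 0 1)ᶜ x w := fun w hw =>
    linked_compl_image_Icc h.continuous zero_le_one h.injOn hx.2 hw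
  obtain hl | hl | hl := linked_compl_union_of_inter_eq_pair hK h.isCompact_image h.ne h.inter_eq
    (linked_of_mem hx.1 hy.1) (harc y hy.2) (linked_of_mem hx.1 hz.1) (harc z hz.2)
  exacts [absurd hl hxy, Or.inl (heq hl), Or.inr (heq hl)]

end IsCrosscut

theorem IsPlaneArc.exists_param {p q : ℂ} {A : Set ℂ} (h : IsPlaneArc p q A) :
    ∃ γ : ℝ → ℂ, Continuous γ ∧ InjOn γ (Icc 0 1) ∧ γ 0 = p ∧ γ 1 = q ∧ γ '' Icc 0 1 = A := by
  obtain ⟨γ, hc, hi, h0, h1, rfl⟩ := h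
  refine ⟨IccExtend zero_le_one γ, hc.Icc_extend', fun s hs t ht hst => ?_,
    by rw [IccExtend_left]; exact h0, by rw [IccExtend_right]; exact h1, ?_⟩
  · rw [IccExtend_of_mem _ _ hs, IccExtend_of_mem _ _ ht] at hst
    exact congrArg Subtype.val (hi hst)
  · ext z
    constructor
    · rintro ⟨t, ht, rfl⟩
      exact ⟨⟨t, ht⟩, (IccExtend_of_mem _ _ ht).symm⟩
    · rintro ⟨t, rfl⟩
      exact ⟨t, t.2, IccExtend_of_mem _ _ t.2⟩

namespace PlaneEmbedding

variable {V : Type*} {G H : SimpleGraph V} (D : PlaneEmbedding G) {e : Sym2 V} {F F' : Set ℂ}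
  {z : ℂ}

/-- The drawing of a spanning subgraph. -/
def mono (h : H ≤ G) : PlaneEmbedding H where
  point := D.point
  arc := D.arc
  point_injective := D.point_injective
  isPlaneArc u v huv := D.isPlaneArc u v (h huv)
  mem_of_point_mem_arc e he := D.mem_of_point_mem_arc e (SimpleGraph.edgeSet_mono h he)
  arc_inter_arc e he e' he' := D.arc_inter_arc e (SimpleGraph.edgeSet_mono h he) e'
    (SimpleGraph.edgeSet_mono h he')

/-- The drawing without one edge. -/
abbrev delete (e : Sym2 V) : PlaneEmbedding (G.deleteEdges {e}) :=
  D.mono (G.deleteEdges_le {e})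

theorem induction_on_delete [Finite V] {motive : ∀ {G : SimpleGraph V}, PlaneEmbedding G → Prop}
    (bot : ∀ D : PlaneEmbedding (⊥ : SimpleGraph V), motive D)
    (delete : ∀ {G : SimpleGraph V} (D : PlaneEmbedding G), ∀ e ∈ G.edgeSet,
      motive (D.delete e) → motive D) : motive D := by
  induction hn : G.edgeSet.ncard generalizing G with
  | zero =>
    obtain rfl := SimpleGraph.edgeSet_eq_empty.1 ((ncard_eq_zero (toFinite _)).1 hn)
    exact bot D
  | succ n ih =>
    obtain ⟨e, he⟩ : G.edgeSet.Nonempty := nonempty_of_ncard_ne_zero (by omega)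
    refine delete D e he (ih (D.delete e) ?_)
    rw [SimpleGraph.edgeSet_deleteEdges, ncard_sdiff_singleton_of_mem he, hn, Nat.add_sub_cancel]

theorem range_point_subset_support : range D.point ⊆ D.support := subset_union_left

theorem arc_subset_support (he : e ∈ G.edgeSet) : D.arc e ⊆ D.support :=
  (subset_biUnion_of_mem (u := D.arc) he).trans subset_union_right

theorem support_mono_subset (h : H ≤ G) : (D.mono h).support ⊆ D.support :=
  union_subset_union_right _ (biUnion_subset_biUnion_left (SimpleGraph.edgeSet_mono h))

theorem support_eq_delete_union (he : e ∈ G.edgeSet) :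
    D.support = (D.delete e).support ∪ D.arc e := by
  have hE : G.edgeSet = insert e (G.deleteEdges {e}).edgeSet := by
    rw [SimpleGraph.edgeSet_deleteEdges, insert_sdiff_singleton, insert_eq_of_mem he]
  rw [support, hE, biUnion_insert, union_comm (D.arc e), ← union_assoc]
  rfl

theorem point_mem_arc (he : e ∈ G.edgeSet) {w : V} (hw : w ∈ e) : D.point w ∈ D.arc e := by
  induction e with | h u v
  obtain ⟨γ, -, -, h0, h1, hγ⟩ := D.isPlaneArc u v he
  rw [← hγ]
  obtain rfl | rfl := Sym2.mem_iff.1 hw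
  exacts [⟨0, h0⟩, ⟨1, h1⟩]

theorem isCompact_arc (he : e ∈ G.edgeSet) : IsCompact (D.arc e) := by
  induction e with | h u v
  obtain ⟨γ, hc, -, -, -, hγ⟩ := D.isPlaneArc u v he
  exact hγ ▸ isCompact_range hc

theorem isCompact_support [Finite V] : IsCompact D.support :=
  (finite_range _).isCompact.union
    ((toFinite _).isCompact_biUnion fun _ he => D.isCompact_arc he)

theorem joinedIn_support_of_reachable {u v : V} (h : G.Reachable u v) :
    JoinedIn D.support (D.point u) (D.point v) := by
  obtain ⟨p⟩ := h
  induction p with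
  | nil => exact JoinedIn.refl (D.range_point_subset_support ⟨_, rfl⟩)
  | @cons u v w huv _ ih =>
    obtain ⟨γ, hc, -, h0, h1, hγ⟩ := D.isPlaneArc u v huv
    exact JoinedIn.trans
      ⟨⟨⟨γ, hc⟩, h0, h1⟩, fun t => D.arc_subset_support huv (hγ ▸ mem_range_self t)⟩ ih

/-- The part of the drawing on a set of vertices. -/
def supportOn (S : Set V) : Set ℂ :=
  D.point '' S ∪ ⋃ e ∈ {e | e ∈ G.edgeSet ∧ ∀ w ∈ e, w ∈ S}, D.arc e

theorem mem_supportOn {S : Set V} : z ∈ D.supportOn S ↔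
    (∃ w ∈ S, D.point w = z) ∨ ∃ e ∈ G.edgeSet, (∀ w ∈ e, w ∈ S) ∧ z ∈ D.arc e := by
  simp only [supportOn, mem_union, mem_image, mem_iUnion, mem_ofPred_eq, exists_prop, and_assoc]

theorem isCompact_supportOn [Finite V] (S : Set V) : IsCompact (D.supportOn S) :=
  (S.toFinite.image _).isCompact.union
    ((toFinite _).isCompact_biUnion fun _ he => D.isCompact_arc he.1)

theorem exists_mem_of_mem_arc_of_mem_supportOn {S : Set V} (he : e ∈ G.edgeSet)
    (hz : z ∈ D.arc e) (hzS : z ∈ D.supportOn S) : ∃ w ∈ e, w ∈ S := by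
  obtain ⟨w, hw, rfl⟩ | ⟨e', he', hS, hz'⟩ := D.mem_supportOn.1 hzS
  · exact ⟨w, D.mem_of_point_mem_arc e he w hz, hw⟩
  · by_cases hee : e = e'
    · subst hee
      exact ⟨_, Sym2.out_fst_mem e, hS _ (Sym2.out_fst_mem e)⟩
    · obtain ⟨w, ⟨hw, hw'⟩, -⟩ := D.arc_inter_arc e he e' he' hee ⟨hz, hz'⟩
      exact ⟨w, hw, hS w hw'⟩

theorem disjoint_supportOn {S T : Set V} (hST : Disjoint S T) :
    Disjoint (D.supportOn S) (D.supportOn T) := by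
  refine disjoint_left.2 fun z hzS hzT => ?_
  obtain ⟨w, hw, rfl⟩ | ⟨e, he, heS, hz⟩ := D.mem_supportOn.1 hzS
  · obtain ⟨w', hw', hww'⟩ | ⟨e, he, heT, hz⟩ := D.mem_supportOn.1 hzT
    · exact disjoint_left.1 hST hw (D.point_injective hww' ▸ hw')
    · exact disjoint_left.1 hST hw (heT w (D.mem_of_point_mem_arc e he w hz))
  · obtain ⟨w, hwe, hwT⟩ := D.exists_mem_of_mem_arc_of_mem_supportOn he hz hzT
    exact disjoint_left.1 hST (heS w hwe) hwT

theorem support_eq_supportOn_union {S : Set V} (hS : ∀ u v, G.Adj u v → u ∈ S → v ∈ S) :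
    D.support = D.supportOn S ∪ D.supportOn Sᶜ := by
  have hedge : ∀ e ∈ G.edgeSet, (∀ w ∈ e, w ∈ S) ∨ ∀ w ∈ e, w ∈ Sᶜ := by
    intro e he
    induction e with | h u v
    simp only [Sym2.ball, mem_compl_iff]
    by_cases hu : u ∈ S
    · exact Or.inl ⟨hu, hS u v he hu⟩
    · exact Or.inr ⟨hu, fun hv => hu (hS v u he.symm hv)⟩
  have harc : G.edgeSet = {e | e ∈ G.edgeSet ∧ ∀ w ∈ e, w ∈ S} ∪
      {e | e ∈ G.edgeSet ∧ ∀ w ∈ e, w ∈ Sᶜ} :=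
    Subset.antisymm (fun e he => (hedge e he).imp (And.intro he) (And.intro he))
      (union_subset (fun _ he => he.1) fun _ he => he.1)
  rw [support, harc, biUnion_union, ← image_univ, ← union_compl_self S, image_union,
    union_union_union_comm]
  rfl

/-- The points of an edge other than its ends. -/
def openArc (e : Sym2 V) : Set ℂ := D.arc e \ range D.point

theorem support_delete_inter_arc (he : e ∈ G.edgeSet) :
    (D.delete e).support ∩ D.arc e = D.point '' {w | w ∈ e} := by
  apply Subset.antisymm
  · rintro z ⟨⟨w, rfl⟩ | hz, hze⟩
    · exact ⟨w, D.mem_of_point_mem_arc e he w hze, rfl⟩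
    · obtain ⟨e', he', hz⟩ := mem_iUnion₂.1 hz
      rw [SimpleGraph.edgeSet_deleteEdges] at he'
      exact image_mono (fun w hw => hw.1) (D.arc_inter_arc e he e' he'.1 (Ne.symm he'.2) ⟨hze, hz⟩)
  · rintro _ ⟨w, hw, rfl⟩
    exact ⟨(D.delete e).range_point_subset_support ⟨w, rfl⟩, D.point_mem_arc he hw⟩

theorem openArc_eq_diff (he : e ∈ G.edgeSet) : D.openArc e = D.arc e \ (D.delete e).support := by
  refine Subset.antisymm (fun z hz => ⟨hz.1, fun hzK => ?_⟩) (sdiff_subset_sdiff_right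
    (D.delete e).range_point_subset_support)
  exact hz.2 (image_subset_range _ _ ((D.support_delete_inter_arc he).subset ⟨hzK, hz.1⟩))

theorem exists_openArc_of_mem_support (hz : z ∈ D.support) (hz' : z ∉ range D.point) :
    ∃ e ∈ G.edgeSet, z ∈ D.openArc e := by
  obtain ⟨e, he, hze⟩ := mem_iUnion₂.1 (hz.resolve_left hz')
  exact ⟨e, he, hze, hz'⟩

theorem exists_isCrosscut {u v : V} (h : G.Adj u v) :
    ∃ γ : ℝ → ℂ, IsCrosscut (D.delete s(u, v)).support γ ∧ γ 0 = D.point u ∧ γ 1 = D.point v ∧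
      γ '' Icc 0 1 = D.arc s(u, v) := by
  obtain ⟨γ, hc, hi, h0, h1, hγ⟩ := (D.isPlaneArc u v h).exists_param
  refine ⟨γ, ⟨hc, hi, ?_⟩, h0, h1, hγ⟩
  have hends : {w | w ∈ s(u, v)} = {u, v} := ext fun w => Sym2.mem_iff
  rw [hγ, h0, h1, D.support_delete_inter_arc h, hends, image_pair]

/-- The faces with a given edge on their boundary. -/
def incidentFaces (e : Sym2 V) : Set (Set ℂ) := {F | F ∈ D.faces ∧ e ∈ D.boundaryEdges F}

variable {γ : ℝ → ℂ}

theorem openArc_subset_component (he : e ∈ G.edgeSet)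
    (hγ : IsCrosscut (D.delete e).support γ) (hγe : γ '' Icc 0 1 = D.arc e) :
    D.openArc e ⊆ connectedComponentIn (D.delete e).supportᶜ (γ (1 / 2)) := by
  rw [D.openArc_eq_diff he, ← hγe]
  exact hγ.image_diff_subset

theorem openArc_nonempty (he : e ∈ G.edgeSet) : (D.openArc e).Nonempty := by
  induction e with | h u v
  obtain ⟨γ, hγ, -, -, hγe⟩ := D.exists_isCrosscut he
  rw [D.openArc_eq_diff he, ← hγe]
  exact ⟨γ (1 / 2), ⟨1 / 2, by norm_num, rfl⟩,
    connectedComponentIn_subset _ _ (hγ.image_Ioo_subset ⟨1 / 2, by norm_num, rfl⟩)⟩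

theorem faces_eq_union_image (he : e ∈ G.edgeSet) (hγ : IsCrosscut (D.delete e).support γ)
    (hγe : γ '' Icc 0 1 = D.arc e) :
    D.faces = (D.delete e).faces \ {connectedComponentIn (D.delete e).supportᶜ (γ (1 / 2))} ∪
      connectedComponentIn D.supportᶜ ''
        (connectedComponentIn (D.delete e).supportᶜ (γ (1 / 2)) \ D.arc e) := by
  have h := hγ.complComponents_union
  rw [hγe, ← D.support_eq_delete_union he] at h
  exact h

section Faces

variable [Finite V]

theorem isOpen_face (hF : F ∈ D.faces) : IsOpen F :=
  isOpen_of_mem_complComponents D.isCompact_support.isClosed hF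

theorem mem_boundaryEdges_of_arc_subset_closure (hF : F ∈ D.faces) (he : e ∈ G.edgeSet)
    (h : D.arc e ⊆ closure F) : e ∈ D.boundaryEdges F := by
  refine ⟨he, fun z hz => ?_⟩
  rw [(D.isOpen_face hF).frontier_eq]
  exact ⟨h hz, fun hzF => subset_compl_of_mem_complComponents hF hzF (D.arc_subset_support he hz)⟩

theorem disjoint_closure_of_ne (hF : F ∈ D.faces) (hF' : F' ∈ D.faces) (hne : F ≠ F') :
    Disjoint (closure F) F' :=
  (disjoint_left.2 fun _ hz hz' => hne (eq_of_mem_complComponents hF hF' hz hz')).closure_left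
    (D.isOpen_face hF')

theorem incidentFaces_eq_image (he : e ∈ G.edgeSet) (hγ : IsCrosscut (D.delete e).support γ)
    (hγe : γ '' Icc 0 1 = D.arc e) :
    D.incidentFaces e = connectedComponentIn D.supportᶜ ''
      (connectedComponentIn (D.delete e).supportᶜ (γ (1 / 2)) \ D.arc e) := by
  have hfaces := D.faces_eq_union_image he hγ hγe
  apply Subset.antisymm
  · rintro F ⟨hF, hFe⟩
    refine (hfaces.subset hF).resolve_left fun ⟨hF', hne⟩ => ?_
    obtain ⟨z, hz⟩ := D.openArc_nonempty he
    exact disjoint_left.1 ((D.delete e).disjoint_closure_of_ne hF' hγ.component_mem_complComponents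
      hne) (frontier_subset_closure (hFe.2 hz.1)) (D.openArc_subset_component he hγ hγe hz)
  · rintro F hF
    have hFD : F ∈ D.faces := hfaces.superset (Or.inr hF)
    obtain ⟨x, hx, rfl⟩ := hF
    refine ⟨hFD, D.mem_boundaryEdges_of_arc_subset_closure hFD he ?_⟩
    rw [← hγe] at hx ⊢
    rw [D.support_eq_delete_union he, ← hγe]
    exact hγ.image_subset_closure (D.delete e).isCompact_support hx

theorem exists_faces_eq_delete_union (he : e ∈ G.edgeSet) :
    ∃ F₀ ∈ (D.delete e).faces, D.openArc e ⊆ F₀ ∧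
      D.faces = (D.delete e).faces \ {F₀} ∪ D.incidentFaces e := by
  induction e with | h u v
  obtain ⟨γ, hγ, -, -, hγe⟩ := D.exists_isCrosscut he
  refine ⟨_, hγ.component_mem_complComponents, D.openArc_subset_component he hγ hγe, ?_⟩
  rw [D.incidentFaces_eq_image he hγ hγe]
  exact D.faces_eq_union_image he hγ hγe

theorem mem_boundaryEdges_of_mem_closure (he : e ∈ G.edgeSet) (hF : F ∈ D.faces)
    (hz : z ∈ D.openArc e) (hzF : z ∈ closure F) : e ∈ D.boundaryEdges F := by
  obtain ⟨F₀, hF₀, ho, hfaces⟩ := D.exists_faces_eq_delete_union he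
  obtain ⟨hF', hne⟩ | hF' := hfaces.subset hF
  · exact absurd (ho hz) (disjoint_left.1 ((D.delete e).disjoint_closure_of_ne hF' hF₀ hne) hzF)
  · exact hF'.2

theorem ncard_incidentFaces_of_isBridge (he : e ∈ G.edgeSet) (hb : G.IsBridge e) :
    (D.incidentFaces e).ncard = 1 := by
  induction e with | h u v
  obtain ⟨γ, hγ, h0, h1, hγe⟩ := D.exists_isCrosscut he
  let S := {w | (G.deleteEdges {s(u, v)}).Reachable u w}
  have hS : ∀ w w', (G.deleteEdges {s(u, v)}).Adj w w' → w ∈ S → w' ∈ S :=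
    fun w w' h hw => SimpleGraph.Reachable.trans hw h.reachable
  rw [D.incidentFaces_eq_image he hγ hγe, D.support_eq_delete_union he, ← hγe]
  rw [(D.delete s(u, v)).support_eq_supportOn_union hS] at hγ ⊢
  exact hγ.ncard_image_eq_one_of_disjoint (isCompact_supportOn _ _) (isCompact_supportOn _ _)
    (disjoint_supportOn _ disjoint_compl_right)
    (Or.inl ⟨u, SimpleGraph.Reachable.refl u, h0.symm⟩)
    (Or.inl ⟨v, SimpleGraph.isBridge_iff.1 hb, h1.symm⟩)

theorem ncard_incidentFaces_of_not_isBridge (he : e ∈ G.edgeSet) (hb : ¬ G.IsBridge e) :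
    (D.incidentFaces e).ncard = 2 := by
  induction e with | h u v
  obtain ⟨γ, hγ, h0, h1, hγe⟩ := D.exists_isCrosscut he
  have hjoin := (D.delete s(u, v)).joinedIn_support_of_reachable
    (not_not.1 (mt SimpleGraph.isBridge_iff.2 hb))
  rw [D.incidentFaces_eq_image he hγ hγe, D.support_eq_delete_union he, ← hγe]
  exact hγ.ncard_image_eq_two_of_joinedIn (D.delete _).isCompact_support (h0 ▸ h1 ▸ hjoin)

theorem ncard_incidentFaces_ne_zero (he : e ∈ G.edgeSet) : (D.incidentFaces e).ncard ≠ 0 := by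
  by_cases hb : G.IsBridge e
  · rw [D.ncard_incidentFaces_of_isBridge he hb]
    exact one_ne_zero
  · rw [D.ncard_incidentFaces_of_not_isBridge he hb]
    exact two_ne_zero

theorem finite_incidentFaces (he : e ∈ G.edgeSet) : (D.incidentFaces e).Finite :=
  finite_of_ncard_ne_zero (D.ncard_incidentFaces_ne_zero he)

theorem isConnected_compl_range_point : IsConnected (range D.point)ᶜ :=
  (finite_range D.point).countable.isConnected_compl_of_one_lt_rank one_lt_rank_real_complex

theorem faces_bot (D : PlaneEmbedding (⊥ : SimpleGraph V)) : D.faces = {(range D.point)ᶜ} := by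
  have hsupp : D.support = range D.point := by
    simp only [support, SimpleGraph.edgeSet_bot, biUnion_empty, union_empty]
  have hcomp : ∀ x ∈ D.supportᶜ, connectedComponentIn D.supportᶜ x = (range D.point)ᶜ := by
    rw [hsupp]
    exact fun x hx => D.isConnected_compl_range_point.isPreconnected.connectedComponentIn hx
  obtain ⟨x, hx⟩ := D.isConnected_compl_range_point.nonempty
  rw [← hsupp] at hx
  refine Subset.antisymm ?_ (singleton_subset_iff.2 ⟨x, hx, (hcomp x hx).symm⟩)
  rintro _ ⟨y, hy, rfl⟩
  exact hcomp y hy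

theorem finite_faces : D.faces.Finite := by
  induction D using induction_on_delete with
  | bot D => exact D.faces_bot ▸ finite_singleton _
  | delete D e he ih =>
    obtain ⟨F₀, -, -, hfaces⟩ := D.exists_faces_eq_delete_union he
    exact hfaces ▸ ih.sdiff.union (D.finite_incidentFaces he)

theorem ncard_faces_add_one (he : e ∈ G.edgeSet) :
    D.faces.ncard + 1 = (D.delete e).faces.ncard + (D.incidentFaces e).ncard := by
  obtain ⟨F₀, hF₀, ho, hfaces⟩ := D.exists_faces_eq_delete_union he
  have hdisj : Disjoint ((D.delete e).faces \ {F₀}) (D.incidentFaces e) := by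
    refine disjoint_left.2 fun F hF hFe => ?_
    obtain ⟨z, hz⟩ := D.openArc_nonempty he
    exact disjoint_left.1 ((D.delete e).disjoint_closure_of_ne hF.1 hF₀ hF.2)
      (frontier_subset_closure (hFe.2.2 hz.1)) (ho hz)
  rw [hfaces, ncard_union_eq hdisj (D.delete e).finite_faces.sdiff (D.finite_incidentFaces he),
    add_right_comm, ncard_sdiff_singleton_add_one hF₀ (D.delete e).finite_faces]

end Faces

end PlaneEmbedding

section ConnectedComponents

variable {V : Type*} {G : SimpleGraph V} {u v a b : V}

theorem reachable_deleteEdges_or_of_reachable (h : G.Reachable a b) :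
    (G.deleteEdges {s(u, v)}).Reachable a b ∨
      (G.deleteEdges {s(u, v)}).Reachable a u ∧ (G.deleteEdges {s(u, v)}).Reachable v b ∨
      (G.deleteEdges {s(u, v)}).Reachable a v ∧ (G.deleteEdges {s(u, v)}).Reachable u b := by
  obtain ⟨p⟩ := h
  induction p with
  | nil => exact Or.inl SimpleGraph.Reachable.rfl
  | @cons a c b hac _ ih =>
    by_cases he : s(a, c) = s(u, v)
    · obtain ⟨rfl, rfl⟩ | ⟨rfl, rfl⟩ := Sym2.eq_iff.1 he
      · obtain h | ⟨-, h⟩ | ⟨-, h⟩ := ih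
        exacts [Or.inr (Or.inl ⟨.rfl, h⟩), Or.inr (Or.inl ⟨.rfl, h⟩), Or.inl h]
      · obtain h | ⟨-, h⟩ | ⟨-, h⟩ := ih
        exacts [Or.inr (Or.inr ⟨.rfl, h⟩), Or.inl h, Or.inr (Or.inr ⟨.rfl, h⟩)]
    · have hac' : (G.deleteEdges {s(u, v)}).Reachable a c :=
        (SimpleGraph.deleteEdges_adj.2 ⟨hac, he⟩).reachable
      exact ih.imp hac'.trans (Or.imp (And.imp_left hac'.trans) (And.imp_left hac'.trans))

theorem card_connectedComponent_deleteEdges_of_not_isBridge {e : Sym2 V} (hb : ¬ G.IsBridge e) :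
    Nat.card (G.deleteEdges {e}).ConnectedComponent = Nat.card G.ConnectedComponent := by
  induction e with | h u v
  have huv : (G.deleteEdges {s(u, v)}).Reachable u v :=
    not_not.1 (mt SimpleGraph.isBridge_iff.2 hb)
  refine Nat.card_congr (Quot.congr (Equiv.refl V) fun a b => ⟨fun h => h.mono
    (G.deleteEdges_le _), fun h => ?_⟩)
  obtain h | ⟨h, h'⟩ | ⟨h, h'⟩ := reachable_deleteEdges_or_of_reachable (u := u) (v := v) h
  exacts [h, h.trans (huv.trans h'), h.trans (huv.symm.trans h')]

theorem card_connectedComponent_deleteEdges_of_isBridge [Finite V] {e : Sym2 V}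
    (he : e ∈ G.edgeSet) (hb : G.IsBridge e) :
    Nat.card (G.deleteEdges {e}).ConnectedComponent = Nat.card G.ConnectedComponent + 1 := by
  induction e with | h u v
  set H := G.deleteEdges {s(u, v)}
  have huv : ¬ H.Reachable u v := SimpleGraph.isBridge_iff.1 hb
  let f : H.ConnectedComponent → G.ConnectedComponent :=
    SimpleGraph.ConnectedComponent.map (SimpleGraph.Hom.ofLE (G.deleteEdges_le _))
  have hinj : InjOn f {H.connectedComponentMk v}ᶜ := by
    intro c hc d hd hcd
    induction c using SimpleGraph.ConnectedComponent.ind with | h a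
    induction d using SimpleGraph.ConnectedComponent.ind with | h b
    have hav : ¬ H.Reachable a v := mt SimpleGraph.ConnectedComponent.sound hc
    have hbv : ¬ H.Reachable b v := mt SimpleGraph.ConnectedComponent.sound hd
    obtain h | ⟨-, h⟩ | ⟨h, -⟩ := reachable_deleteEdges_or_of_reachable (u := u) (v := v)
      (SimpleGraph.ConnectedComponent.exact hcd)
    exacts [SimpleGraph.ConnectedComponent.sound h, absurd h.symm hbv, absurd h hav]
  have himage : f '' {H.connectedComponentMk v}ᶜ = univ := by
    refine eq_univ_of_forall fun c => ?_
    induction c using SimpleGraph.ConnectedComponent.ind with | h a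
    by_cases hav : H.Reachable a v
    · exact ⟨H.connectedComponentMk u, mt SimpleGraph.ConnectedComponent.exact huv,
        SimpleGraph.ConnectedComponent.sound
          ((SimpleGraph.Adj.reachable he).trans (hav.mono (G.deleteEdges_le _)).symm)⟩
    · exact ⟨H.connectedComponentMk a, mt SimpleGraph.ConnectedComponent.exact hav, rfl⟩
  have hcard := hinj.ncard_image
  rw [himage, ncard_univ] at hcard
  rw [hcard, ← ncard_add_ncard_compl {H.connectedComponentMk v}, ncard_singleton, add_comm]

theorem card_connectedComponent_bot :
    Nat.card (⊥ : SimpleGraph V).ConnectedComponent = Nat.card V :=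
  (Nat.card_congr (Equiv.ofBijective (⊥ : SimpleGraph V).connectedComponentMk
    ⟨fun _ _ h => SimpleGraph.reachable_bot.1 (SimpleGraph.ConnectedComponent.exact h),
      Quot.mk_surjective⟩)).symm

end ConnectedComponents

namespace PlaneEmbedding

variable {V : Type*} {G H : SimpleGraph V} (D : PlaneEmbedding G) {e : Sym2 V} {F F' : Set ℂ}
  {z : ℂ}

/-- The graph formed by the boundary edges of a face. -/
def boundaryGraph (F : Set ℂ) : SimpleGraph V := SimpleGraph.fromEdgeSet (D.boundaryEdges F)

theorem edgeSet_boundaryGraph (F : Set ℂ) : (D.boundaryGraph F).edgeSet = D.boundaryEdges F := by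
  rw [boundaryGraph, SimpleGraph.edgeSet_fromEdgeSet, sdiff_eq_left, Set.disjoint_left]
  exact fun e he hd => G.not_isDiag_of_mem_edgeSet he.1 hd

theorem boundaryGraph_le (F : Set ℂ) : D.boundaryGraph F ≤ G := by
  rw [← SimpleGraph.edgeSet_subset_edgeSet, edgeSet_boundaryGraph]
  exact fun e he => he.1

variable [Finite V]

theorem ncard_faces_add_card : D.faces.ncard + Nat.card V =
    G.edgeSet.ncard + Nat.card G.ConnectedComponent + 1 := by
  induction D using induction_on_delete with
  | bot D =>
    rw [D.faces_bot, ncard_singleton, SimpleGraph.edgeSet_bot, ncard_empty,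
      card_connectedComponent_bot, zero_add, add_comm]
  | @delete G D e he ih =>
    have hfaces := D.ncard_faces_add_one he
    have hedges := ncard_sdiff_singleton_add_one he
    rw [SimpleGraph.edgeSet_deleteEdges] at ih
    by_cases hb : G.IsBridge e
    · have := D.ncard_incidentFaces_of_isBridge he hb
      have := card_connectedComponent_deleteEdges_of_isBridge he hb
      omega
    · have := D.ncard_incidentFaces_of_not_isBridge he hb
      have := card_connectedComponent_deleteEdges_of_not_isBridge hb
      omega

theorem dense_compl_support : Dense D.supportᶜ := by
  rw [support, compl_union, compl_iUnion₂]
  refine ((finite_range _).countable.dense_compl ℝ).inter_of_isOpen_left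
    (dense_biInter_of_isOpen (fun e he => (D.isCompact_arc he).isClosed.isOpen_compl)
      (toFinite _).countable fun e he => ?_) (finite_range _).isClosed.isOpen_compl
  induction e with | h u v
  obtain ⟨γ, hc, hi, -, -, hγ⟩ := (D.isPlaneArc u v he).exists_param
  rw [← interior_eq_empty_iff_dense_compl, ← hγ]
  exact interior_image_Icc_eq_empty one_lt_rank_real_complex hc hi

theorem exists_face_mem_closure (z : ℂ) : ∃ F ∈ D.faces, z ∈ closure F := by
  have hsub : D.supportᶜ ⊆ ⋃ F ∈ D.faces, F := fun w hw =>
    mem_biUnion (connectedComponentIn_mem_complComponents hw) (mem_connectedComponentIn hw)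
  have hz := closure_mono hsub (D.dense_compl_support z)
  rw [D.finite_faces.closure_biUnion] at hz
  simpa only [mem_iUnion, exists_prop] using hz

theorem exists_mem_closure_inter_closure {𝓕 : Set (Set ℂ)} (hsub : 𝓕 ⊆ D.faces)
    (hne : 𝓕.Nonempty) (hne' : (D.faces \ 𝓕).Nonempty) :
    ∃ F ∈ 𝓕, ∃ F' ∈ D.faces \ 𝓕, ∃ z ∉ range D.point, z ∈ closure F ∧ z ∈ closure F' := by
  have hclosed : ∀ 𝓖 ⊆ D.faces, IsClosed (⋃ F ∈ 𝓖, closure F) := fun 𝓖 h𝓖 =>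
    (D.finite_faces.subset h𝓖).isClosed_biUnion fun _ _ => isClosed_closure
  have hmeet : ∀ 𝓖 ⊆ D.faces, 𝓖.Nonempty → ((range D.point)ᶜ ∩ ⋃ F ∈ 𝓖, closure F).Nonempty := by
    rintro 𝓖 h𝓖 ⟨F, hF⟩
    obtain ⟨w, hw⟩ := (isConnected_of_mem_complComponents (h𝓖 hF)).nonempty
    exact ⟨w, fun hw' => subset_compl_of_mem_complComponents (h𝓖 hF) hw (Or.inl hw'),
      mem_biUnion hF (subset_closure hw)⟩
  have hcover : (range D.point)ᶜ ⊆ (⋃ F ∈ 𝓕, closure F) ∪ ⋃ F ∈ D.faces \ 𝓕, closure F := by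
    rw [← biUnion_union, union_sdiff_cancel hsub]
    exact fun z _ => by
      simpa only [mem_iUnion, exists_prop] using D.exists_face_mem_closure z
  obtain ⟨z, hz, hz1, hz2⟩ := isPreconnected_closed_iff.1
    D.isConnected_compl_range_point.isPreconnected _ _ (hclosed 𝓕 hsub)
    (hclosed (D.faces \ 𝓕) sdiff_subset) hcover (hmeet _ hsub hne) (hmeet _ sdiff_subset hne')
  obtain ⟨F, hF, hzF⟩ := mem_iUnion₂.1 hz1
  obtain ⟨F', hF', hzF'⟩ := mem_iUnion₂.1 hz2
  exact ⟨F, hF, F', hF', z, hz, hzF, hzF'⟩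

theorem eq_faces_of_incidentFaces_subset {𝓕 : Set (Set ℂ)} (hsub : 𝓕 ⊆ D.faces)
    (hne : 𝓕.Nonempty) (h : ∀ F ∈ 𝓕, ∀ e ∈ D.boundaryEdges F, D.incidentFaces e ⊆ 𝓕) :
    𝓕 = D.faces := by
  by_contra hcon
  obtain ⟨F, hF, F', ⟨hF', hF'n⟩, z, hz, hzF, hzF'⟩ := D.exists_mem_closure_inter_closure hsub hne
    (sdiff_nonempty.2 fun hsub' => hcon (hsub.antisymm hsub'))
  refine hF'n ?_
  by_cases hzs : z ∈ D.support
  · obtain ⟨e, he, hze⟩ := D.exists_openArc_of_mem_support hzs hz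
    exact h F hF e (D.mem_boundaryEdges_of_mem_closure he (hsub hF) hze hzF)
      ⟨hF', D.mem_boundaryEdges_of_mem_closure he hF' hze hzF'⟩
  · have hmem : ∀ F ∈ D.faces, z ∈ closure F → z ∈ F := fun F hF =>
      mem_of_mem_closure_of_mem_complComponents D.isCompact_support.isClosed hF hzs
    exact eq_of_mem_complComponents (hsub hF) hF' (hmem F (hsub hF) hzF) (hmem F' hF' hzF') ▸ hF

theorem edgeSet_eq_biUnion_boundaryEdges {𝓕 : Set (Set ℂ)} (hsub : 𝓕 ⊆ D.faces)
    (hne : 𝓕.Nonempty) (h : ∀ F ∈ 𝓕, ∀ e ∈ D.boundaryEdges F, D.incidentFaces e ⊆ 𝓕) :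
    G.edgeSet = ⋃ F ∈ 𝓕, D.boundaryEdges F := by
  refine Subset.antisymm (fun e he => ?_) (iUnion₂_subset fun F _ e he => he.1)
  obtain ⟨F, hF, heF⟩ := nonempty_of_ncard_ne_zero (D.ncard_incidentFaces_ne_zero he)
  rw [← D.eq_faces_of_incidentFaces_subset hsub hne h] at hF
  exact mem_biUnion hF heF

theorem mem_faces_boundaryGraph (hF : F ∈ D.faces) :
    F ∈ (D.mono (D.boundaryGraph_le F)).faces := by
  refine mem_complComponents_of_frontier_subset (isConnected_of_mem_complComponents hF)
    (D.isOpen_face hF) ((subset_compl_of_mem_complComponents hF).trans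
      (compl_subset_compl.2 (D.support_mono_subset _))) fun z hz => ?_
  rw [(D.isOpen_face hF).frontier_eq] at hz
  by_cases hzp : z ∈ range D.point
  · exact Or.inl hzp
  · have hzs : z ∈ D.support := not_not.1 fun h => hz.2
      (mem_of_mem_closure_of_mem_complComponents D.isCompact_support.isClosed hF h hz.1)
    obtain ⟨e, he, hze⟩ := D.exists_openArc_of_mem_support hzs hzp
    have heF := D.mem_boundaryEdges_of_mem_closure he hF hze hz.1
    rw [← edgeSet_boundaryGraph] at heF
    exact (D.mono (D.boundaryGraph_le F)).arc_subset_support heF hze.1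

theorem exists_mem_incidentFaces_mono (h : H ≤ G) (heH : e ∈ H.edgeSet)
    (hF : F ∈ D.incidentFaces e) : ∃ F' ∈ (D.mono h).incidentFaces e, F ⊆ F' := by
  obtain ⟨x, hx⟩ := (isConnected_of_mem_complComponents hF.1).nonempty
  have hFs : F ⊆ (D.mono h).supportᶜ := (subset_compl_of_mem_complComponents hF.1).trans
    (compl_subset_compl.2 (D.support_mono_subset h))
  have hsub := (isConnected_of_mem_complComponents hF.1).isPreconnected.subset_connectedComponentIn
    hx hFs
  refine ⟨_, ⟨connectedComponentIn_mem_complComponents (hFs hx), ?_⟩, hsub⟩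
  exact (D.mono h).mem_boundaryEdges_of_arc_subset_closure
    (connectedComponentIn_mem_complComponents (hFs hx)) heH
    ((hF.2.2.trans frontier_subset_closure).trans (closure_mono hsub))

theorem not_isBridge_boundaryGraph (hF : F ∈ D.faces) (he : e ∈ D.boundaryEdges F)
    (hb : ¬ G.IsBridge e) : ¬ (D.boundaryGraph F).IsBridge e := by
  intro hb'
  have heH : e ∈ (D.boundaryGraph F).edgeSet := by rwa [edgeSet_boundaryGraph]
  obtain ⟨F₁, hF₁⟩ := ncard_eq_one.1
    ((D.mono (D.boundaryGraph_le F)).ncard_incidentFaces_of_isBridge heH hb')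
  obtain ⟨F', hF', hne⟩ := exists_ne_of_one_lt_ncard
    (one_lt_two.trans_eq (D.ncard_incidentFaces_of_not_isBridge he.1 hb).symm) F
  obtain ⟨E, hE, hFE⟩ := D.exists_mem_incidentFaces_mono (D.boundaryGraph_le F) heH hF'
  have hFF : F ∈ (D.mono (D.boundaryGraph_le F)).incidentFaces e :=
    ⟨D.mem_faces_boundaryGraph hF, heH, he.2⟩
  rw [hF₁, mem_singleton_iff] at hE hFF
  obtain ⟨x, hx⟩ := (isConnected_of_mem_complComponents hF'.1).nonempty
  exact hne (eq_of_mem_complComponents hF'.1 hF hx (hFF.trans hE.symm ▸ hFE hx))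

end PlaneEmbedding

section Triangles

variable {V : Type*} {G : SimpleGraph V} {T T' : Set (Sym2 V)} {e : Sym2 V} {u v w w' : V}

theorem ncard_edgeSet_of_isTrail {p : G.Walk u v} (hp : p.IsTrail) :
    p.edgeSet.ncard = p.length := by
  classical
  rw [← SimpleGraph.Walk.coe_edges_toFinset, ncard_coe_finset,
    List.toFinset_card_of_nodup hp.edges_nodup, p.length_edges]

theorem length_ne_of_free_cycleGraph {n : ℕ} (hn : 2 < n) (hC : (SimpleGraph.cycleGraph n).Free G)
    {p : G.Walk u u} (hp : p.IsCycle) : p.length ≠ n := fun h =>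
  hC ((SimpleGraph.cycleGraph_isContained_iff hn).2 ⟨u, p, hp, h⟩)

/-- `T` is the edge set of a cycle of length 3 of `G`. -/
def IsTriangleEdges (G : SimpleGraph V) (T : Set (Sym2 V)) : Prop :=
  ∃ (u : V) (p : G.Walk u u), p.IsCycle ∧ p.length = 3 ∧ p.edgeSet = T

theorem isTriangleEdges_of_adj (huv : G.Adj u v) (hvw : G.Adj v w) (hwu : G.Adj w u) :
    IsTriangleEdges G {s(u, v), s(v, w), s(w, u)} := by
  refine ⟨u, .cons huv (.cons hvw (.cons hwu .nil)), ?_, rfl, ?_⟩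
  · simp [SimpleGraph.Walk.isCycle_def, SimpleGraph.Walk.isTrail_def, huv.ne, huv.ne', hvw.ne,
      hwu.ne, hwu.ne']
  · simp [SimpleGraph.Walk.edgeSet_cons]

theorem eq_of_free_cycleGraph_four (hC : (SimpleGraph.cycleGraph 4).Free G) (huv : u ≠ v)
    (huw : G.Adj u w) (hvw : G.Adj v w) (huw' : G.Adj u w') (hvw' : G.Adj v w') : w = w' := by
  by_contra hne
  refine length_ne_of_free_cycleGraph (by norm_num) hC
    (p := .cons huw (.cons hvw.symm (.cons hvw' (.cons huw'.symm .nil)))) ?_ rfl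
  simp [SimpleGraph.Walk.isCycle_def, SimpleGraph.Walk.isTrail_def, huv, huv.symm, hne,
    huw.ne, huw.ne', hvw.ne', huw'.ne, huw'.ne', hvw'.ne]

namespace IsTriangleEdges

theorem ncard (hT : IsTriangleEdges G T) : T.ncard = 3 := by
  obtain ⟨u, p, hp, hl, rfl⟩ := hT
  rw [ncard_edgeSet_of_isTrail hp.isTrail, hl]

theorem not_isBridge (hT : IsTriangleEdges G T) (he : e ∈ T) : ¬ G.IsBridge e := by
  obtain ⟨u, p, hp, -, rfl⟩ := hT
  exact fun hb => hb.notMem_edges_of_isCycle hp he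

theorem exists_of_mem (hT : IsTriangleEdges G T) (h : s(u, v) ∈ T) :
    ∃ w, G.Adj u v ∧ G.Adj v w ∧ G.Adj w u ∧ T = {s(u, v), s(v, w), s(w, u)} := by
  obtain ⟨a, p, -, hl, rfl⟩ := hT
  match p, hl with
  | .cons (v := b) hab (.cons (v := c) hbc (.cons hca .nil)), _ =>
    simp only [SimpleGraph.Walk.edgeSet_cons, SimpleGraph.Walk.edgeSet_nil, insert_empty_eq] at h ⊢
    have hrot : ∀ x y z : V, ({s(x, y), s(y, z), s(z, x)} : Set (Sym2 V)) =
        {s(y, z), s(z, x), s(x, y)} := fun x y z => by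
      rw [insert_comm, pair_comm s(x, y)]
    have hswap : ∀ x y z : V, ({s(x, y), s(y, z), s(z, x)} : Set (Sym2 V)) =
        {s(y, x), s(x, z), s(z, y)} := fun x y z => by
      rw [pair_comm, Sym2.eq_swap (a := x), Sym2.eq_swap (a := y) (b := z),
        Sym2.eq_swap (a := z)]
    obtain h | h | h := h <;> obtain ⟨rfl, rfl⟩ | ⟨rfl, rfl⟩ := Sym2.eq_iff.1 h
    exacts [⟨c, hab, hbc, hca, rfl⟩,
      ⟨c, hab.symm, hca.symm, hbc.symm, hswap _ _ _⟩,
      ⟨a, hbc, hca, hab, hrot _ _ _⟩,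
      ⟨a, hbc.symm, hab.symm, hca.symm, (hrot _ _ _).trans (hswap _ _ _)⟩,
      ⟨b, hca, hab, hbc, (hrot _ _ _).symm⟩,
      ⟨b, hca.symm, hbc.symm, hab.symm, (hrot _ _ _).symm.trans (hswap _ _ _)⟩]

theorem eq_of_mem (hC : (SimpleGraph.cycleGraph 4).Free G) (hT : IsTriangleEdges G T)
    (hT' : IsTriangleEdges G T') (he : e ∈ T) (he' : e ∈ T') : T = T' := by
  induction e with | h u v
  obtain ⟨w, huv, hvw, hwu, rfl⟩ := hT.exists_of_mem he
  obtain ⟨w', -, hvw', hwu', rfl⟩ := hT'.exists_of_mem he'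
  rw [eq_of_free_cycleGraph_four hC huv.ne hwu.symm hvw hwu'.symm hvw']

end IsTriangleEdges

theorem mem_edgesInNoTriangle :
    e ∈ edgesInNoTriangle G ↔ e ∈ G.edgeSet ∧ ∀ T, IsTriangleEdges G T → e ∉ T := by
  refine and_congr_right fun he => ⟨?_, ?_⟩
  · rintro h T hT heT
    induction e with | h u v
    obtain ⟨w, huv, hvw, hwu, -⟩ := hT.exists_of_mem heT
    exact h ⟨u, v, w, huv, hvw, hwu, rfl⟩
  · rintro h ⟨u, v, w, huv, hvw, hwu, rfl⟩
    exact h _ (isTriangleEdges_of_adj huv hvw hwu) (mem_insert _ _)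

end Triangles

namespace PlaneEmbedding

variable {V : Type*} {G : SimpleGraph V} (D : PlaneEmbedding G) {e : Sym2 V} {F F' : Set ℂ}

/-- The bridges on the boundary of a face, which its length counts twice. -/
def boundaryBridges (F : Set ℂ) : Set (Sym2 V) := {e | e ∈ D.boundaryEdges F ∧ G.IsBridge e}

/-- The edges on the boundary of a face that its length counts once. -/
def boundaryNonbridges (F : Set ℂ) : Set (Sym2 V) := {e | e ∈ D.boundaryEdges F ∧ ¬ G.IsBridge e}

theorem boundaryNonbridges_union_boundaryBridges :
    D.boundaryNonbridges F ∪ D.boundaryBridges F = D.boundaryEdges F := by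
  ext e
  simp only [boundaryNonbridges, boundaryBridges, mem_union, mem_ofPred_eq]
  tauto

variable [Finite V]

theorem faceLength_eq : D.faceLength F =
    (D.boundaryNonbridges F).ncard + 2 * (D.boundaryBridges F).ncard := by
  have hd : Disjoint (D.boundaryNonbridges F) (D.boundaryBridges F) :=
    disjoint_left.2 fun e he he' => he.2 he'.2
  rw [faceLength, ← D.boundaryNonbridges_union_boundaryBridges,
    ncard_union_eq hd (toFinite _) (toFinite _), D.boundaryNonbridges_union_boundaryBridges,
    two_mul, add_assoc]
  rfl

theorem faceLength_of_isTriangleEdges (h : IsTriangleEdges G (D.boundaryEdges F)) :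
    D.faceLength F = 3 := by
  have hb : D.boundaryBridges F = ∅ :=
    eq_empty_of_forall_notMem fun e he => h.not_isBridge he.1 he.2
  have hn := D.boundaryNonbridges_union_boundaryBridges (F := F)
  rw [hb, union_empty] at hn
  rw [faceLength_eq, hb, ncard_empty, hn, h.ncard]

theorem exists_isCycle_of_mem_boundaryNonbridges (hF : F ∈ D.faces)
    (he : e ∈ D.boundaryNonbridges F) :
    ∃ (u : V) (p : G.Walk u u), p.IsCycle ∧ e ∈ p.edgeSet ∧ p.edgeSet ⊆ D.boundaryNonbridges F := by
  have h := D.not_isBridge_boundaryGraph hF he.1 he.2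
  rw [SimpleGraph.isBridge_iff_forall_cycle_notMem (by rw [edgeSet_boundaryGraph]; exact he.1)] at h
  push Not at h
  obtain ⟨u, p, hp, hep⟩ := h
  have hcyc := hp.mapLe (D.boundaryGraph_le F)
  have hedges := p.edgeSet_mapLe_eq_edgeSet (h := D.boundaryGraph_le F)
  refine ⟨u, p.mapLe (D.boundaryGraph_le F), hcyc, hedges.symm ▸ hep, fun e' he' => ⟨?_, fun hb =>
    hb.notMem_edges_of_isCycle hcyc he'⟩⟩
  rw [hedges] at he'
  exact D.edgeSet_boundaryGraph F ▸ p.edges_subset_edgeSet he'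

theorem boundaryEdges_eq_edgeSet_of_forall_isBridge (hF : F ∈ D.faces)
    (h : ∀ e ∈ D.boundaryEdges F, G.IsBridge e) : D.boundaryEdges F = G.edgeSet := by
  have h' := D.edgeSet_eq_biUnion_boundaryEdges (singleton_subset_iff.2 hF)
    (singleton_nonempty F) ?_
  · rw [h', biUnion_singleton]
  rintro _ rfl e he
  obtain ⟨E, hE⟩ := ncard_eq_one.1 (D.ncard_incidentFaces_of_isBridge he.1 (h e he))
  have hFE : _ ∈ D.incidentFaces e := ⟨hF, he⟩
  rw [hE] at hFE ⊢
  rw [mem_singleton_iff.1 hFE]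

theorem nonempty_boundaryNonbridges_or_faceLength_eq (hF : F ∈ D.faces) :
    (D.boundaryNonbridges F).Nonempty ∨ D.faceLength F = 2 * G.edgeSet.ncard := by
  refine or_iff_not_imp_left.2 fun hne => ?_
  have hempty := not_nonempty_iff_eq_empty.1 hne
  have hbr := D.boundaryNonbridges_union_boundaryBridges (F := F)
  rw [hempty, empty_union] at hbr
  rw [faceLength_eq, hempty, ncard_empty, zero_add, hbr,
    D.boundaryEdges_eq_edgeSet_of_forall_isBridge hF fun e he => (hbr.superset he).2]

theorem isTriangleEdges_of_faceLength_eq_three (hF : F ∈ D.faces) (h3 : D.faceLength F = 3) :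
    IsTriangleEdges G (D.boundaryEdges F) := by
  have hlen := D.faceLength_eq (F := F)
  obtain ⟨e, he⟩ : (D.boundaryNonbridges F).Nonempty := nonempty_of_ncard_ne_zero (by omega)
  obtain ⟨u, p, hp, -, hpS⟩ := D.exists_isCycle_of_mem_boundaryNonbridges hF he
  have hle := ncard_le_ncard hpS (toFinite _)
  have hl := hp.three_le_length
  rw [ncard_edgeSet_of_isTrail hp.isTrail] at hle
  have hB : D.boundaryBridges F = ∅ := (ncard_eq_zero (toFinite _)).1 (by omega)
  refine ⟨u, p, hp, by omega, ?_⟩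
  rw [← D.boundaryNonbridges_union_boundaryBridges, hB, union_empty]
  exact eq_of_subset_of_ncard_le hpS (by rw [ncard_edgeSet_of_isTrail hp.isTrail]; omega)
    (toFinite _)

theorem isTriangleEdges_boundaryNonbridges (hC : (SimpleGraph.cycleGraph 4).Free G)
    (hF : F ∈ D.faces) (hne : (D.boundaryNonbridges F).Nonempty)
    (h4 : (D.boundaryNonbridges F).ncard ≤ 4) : IsTriangleEdges G (D.boundaryNonbridges F) := by
  have hcover : ∀ e ∈ D.boundaryNonbridges F, ∃ T ⊆ D.boundaryNonbridges F, e ∈ T ∧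
      IsTriangleEdges G T := by
    intro e he
    obtain ⟨u, p, hp, hep, hpS⟩ := D.exists_isCycle_of_mem_boundaryNonbridges hF he
    have hle := ncard_le_ncard hpS (toFinite _)
    rw [ncard_edgeSet_of_isTrail hp.isTrail] at hle
    have := hp.three_le_length
    have := length_ne_of_free_cycleGraph (by norm_num) hC hp
    exact ⟨p.edgeSet, hpS, hep, u, p, hp, by omega, rfl⟩
  obtain ⟨e, he⟩ := hne
  obtain ⟨T, hTS, -, hT⟩ := hcover e he
  suffices hST : D.boundaryNonbridges F ⊆ T by rwa [hST.antisymm hTS]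
  intro e' he'
  obtain ⟨T', hTS', heT', hT'⟩ := hcover e' he'
  have hmeet : ¬ Disjoint T T' := fun hd => by
    have hunion := ncard_union_eq hd (toFinite _) (toFinite _)
    have hle := ncard_le_ncard (union_subset hTS hTS') (toFinite _)
    rw [hT.ncard, hT'.ncard] at hunion
    omega
  obtain ⟨e'', h, h'⟩ := not_disjoint_iff.1 hmeet
  rwa [hT.eq_of_mem hC hT' h h']

theorem faceLength_eq_three_or_five_le (hC : (SimpleGraph.cycleGraph 4).Free G)
    (hG : 3 ≤ G.edgeSet.ncard) (hF : F ∈ D.faces) :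
    D.faceLength F = 3 ∨ 5 ≤ D.faceLength F := by
  have hlen := D.faceLength_eq (F := F)
  obtain hne | h := D.nonempty_boundaryNonbridges_or_faceLength_eq hF
  · by_cases h4 : (D.boundaryNonbridges F).ncard ≤ 4
    · have := (D.isTriangleEdges_boundaryNonbridges hC hF hne h4).ncard
      omega
    · omega
  · omega

theorem eq_of_mem_boundaryEdges_of_faceLength_eq_three (hC : (SimpleGraph.cycleGraph 4).Free G)
    (hG : ¬ IsTriangleEdges G G.edgeSet) (hF : F ∈ D.faces) (hF' : F' ∈ D.faces)
    (h3 : D.faceLength F = 3) (h3' : D.faceLength F' = 3) (he : e ∈ D.boundaryEdges F)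
    (he' : e ∈ D.boundaryEdges F') : F = F' := by
  by_contra hne
  have hT := D.isTriangleEdges_of_faceLength_eq_three hF h3
  have hTT : D.boundaryEdges F = D.boundaryEdges F' :=
    hT.eq_of_mem hC (D.isTriangleEdges_of_faceLength_eq_three hF' h3') he he'
  have hpair : ∀ E ∈ ({F, F'} : Set (Set ℂ)), D.boundaryEdges E = D.boundaryEdges F := by
    rintro _ (rfl | rfl)
    exacts [rfl, hTT.symm]
  have hinc : ∀ e ∈ D.boundaryEdges F, {F, F'} = D.incidentFaces e := fun e he =>
    eq_of_subset_of_ncard_le (pair_subset ⟨hF, he⟩ ⟨hF', hTT ▸ he⟩)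
      (by rw [ncard_pair hne, D.ncard_incidentFaces_of_not_isBridge he.1 (hT.not_isBridge he)])
      (D.finite_incidentFaces he.1)
  have hall := D.edgeSet_eq_biUnion_boundaryEdges (pair_subset hF hF') (insert_nonempty _ _)
    fun E hE e he => (hinc e (hpair E hE ▸ he)).superset
  rw [biUnion_pair, ← hTT, union_self] at hall
  exact hG (hall ▸ hT)

end PlaneEmbedding

section Counting

variable {V : Type*} {G : SimpleGraph V} {F : Set ℂ}

theorem sum_ncard_eq_mul_ncard {α β : Type*} {s : Finset α} {t : Set β} (ht : t.Finite)
    {f : α → Set β} {n : ℕ} (hf : ∀ a ∈ s, f a ⊆ t)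
    (h : ∀ b ∈ t, {a | a ∈ s ∧ b ∈ f a}.ncard = n) : ∑ a ∈ s, (f a).ncard = n * t.ncard := by
  classical
  lift t to Finset β using ht
  have habove : ∀ a ∈ s, (f a).ncard = (t.bipartiteAbove (fun a b => b ∈ f a) a).card :=
    fun a ha => by
      rw [← ncard_coe_finset, Finset.coe_bipartiteAbove]
      congr 1
      ext b
      exact ⟨fun hb => ⟨hf a ha hb, hb⟩, fun hb => hb.2⟩
  have hbelow : ∀ b ∈ t, (s.bipartiteBelow (fun a b => b ∈ f a) b).card = n := fun b hb => by
    rw [← h b hb, ← ncard_coe_finset, Finset.coe_bipartiteBelow]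
  rw [Finset.sum_congr rfl habove, Finset.sum_card_bipartiteAbove_eq_sum_card_bipartiteBelow,
    Finset.sum_congr rfl hbelow, Finset.sum_const, smul_eq_mul, mul_comm, ncard_coe_finset]

theorem card_connectedComponent_of_connected (hG : G.Connected) :
    Nat.card G.ConnectedComponent = 1 :=
  have := hG.nonempty
  Nat.card_eq_one_iff_unique.2 ⟨hG.preconnected.subsingleton_connectedComponent, inferInstance⟩

theorem three_le_ncard_edgeSet_of_connected (hG : G.Connected) (hn : 4 ≤ Nat.card V) :
    3 ≤ G.edgeSet.ncard := by
  have hle := hG.card_vert_le_card_edgeSet_add_one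
  rw [Nat.card_coe_set_eq] at hle
  omega

theorem not_isTriangleEdges_edgeSet_of_connected [Finite V] (hG : G.Connected)
    (hn : 4 ≤ Nat.card V) : ¬ IsTriangleEdges G G.edgeSet := fun hT => by
  have hle := hG.card_vert_le_card_edgeSet_add_one
  have h3 := hT.ncard
  rw [← Nat.card_coe_set_eq] at h3
  have htree : G.IsTree := SimpleGraph.isTree_iff_connected_and_card.2 ⟨hG, by omega⟩
  obtain ⟨u, p, hp, -⟩ := hT
  exact htree.isAcyclic p hp

namespace PlaneEmbedding

variable (D : PlaneEmbedding G)

theorem tau_eq_ncard_edgesInNoTriangle [Finite V] (hT : D.TrianglesBoundFaces) :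
    D.tau = (edgesInNoTriangle G).ncard := by
  rw [tau]
  congr 1
  ext e
  rw [mem_edgesInNoTriangle]
  refine and_congr_right fun _ => ⟨?_, ?_⟩
  · rintro h T hT' heT
    induction e with | h u v
    obtain ⟨w, huv, hvw, hwu, rfl⟩ := hT'.exists_of_mem heT
    obtain ⟨F, hF, hb⟩ := hT u v w huv hvw hwu
    exact h ⟨F, hF, D.faceLength_of_isTriangleEdges (hb ▸ hT'), hb ▸ heT⟩
  · rintro h ⟨F, hF, h3, he⟩
    exact h _ (D.isTriangleEdges_of_faceLength_eq_three hF h3) he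

variable [Finite V]

theorem sum_faceLength : ∑ F ∈ D.finite_faces.toFinset, D.faceLength F = 2 * G.edgeSet.ncard := by
  have hfaces : ∀ (S : Set ℂ → Set (Sym2 V)) e, (∀ F, e ∈ S F ↔ e ∈ D.boundaryEdges F) →
      {F | F ∈ D.finite_faces.toFinset ∧ e ∈ S F} = D.incidentFaces e := fun S e hS => by
    simp only [D.finite_faces.mem_toFinset, hS]
    rfl
  have hnonbridges : ∑ F ∈ D.finite_faces.toFinset, (D.boundaryNonbridges F).ncard =
      2 * {e | e ∈ G.edgeSet ∧ ¬ G.IsBridge e}.ncard :=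
    sum_ncard_eq_mul_ncard (toFinite _) (fun F _ e he => ⟨he.1.1, he.2⟩) fun e he => by
      rw [hfaces _ _ fun F => and_iff_left he.2, D.ncard_incidentFaces_of_not_isBridge he.1 he.2]
  have hbridges : ∑ F ∈ D.finite_faces.toFinset, (D.boundaryBridges F).ncard =
      1 * {e | e ∈ G.edgeSet ∧ G.IsBridge e}.ncard :=
    sum_ncard_eq_mul_ncard (toFinite _) (fun F _ e he => ⟨he.1.1, he.2⟩) fun e he => by
      rw [hfaces _ _ fun F => and_iff_left he.2, D.ncard_incidentFaces_of_isBridge he.1 he.2]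
  have hedges : {e | e ∈ G.edgeSet ∧ G.IsBridge e}.ncard +
      {e | e ∈ G.edgeSet ∧ ¬ G.IsBridge e}.ncard = G.edgeSet.ncard :=
    ncard_inter_add_ncard_sdiff_eq_ncard G.edgeSet {e | G.IsBridge e} (toFinite _)
  simp only [faceLength_eq]
  rw [Finset.sum_add_distrib, ← Finset.mul_sum, hnonbridges, hbridges, ← hedges]
  ring

theorem three_mul_numFaces_add_tau (hC : (SimpleGraph.cycleGraph 4).Free G)
    (hG : ¬ IsTriangleEdges G G.edgeSet) : 3 * D.numFaces 3 + D.tau = G.edgeSet.ncard := by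
  have hfin : {F | F ∈ D.faces ∧ D.faceLength F = 3}.Finite := D.finite_faces.subset fun _ h => h.1
  have hcovered : ∑ F ∈ hfin.toFinset, (D.boundaryEdges F).ncard =
      1 * (G.edgeSet \ D.uncoveredEdges).ncard := by
    refine sum_ncard_eq_mul_ncard (toFinite _) (fun F hF e he => ⟨he.1, fun hu => ?_⟩) ?_
    · rw [hfin.mem_toFinset] at hF
      exact hu.2 ⟨F, hF.1, hF.2, he⟩
    · rintro e ⟨he, hu⟩
      obtain ⟨F, hF, h3, heF⟩ := not_not.1 fun h => hu ⟨he, h⟩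
      refine ncard_eq_one.2 ⟨F, eq_singleton_iff_unique_mem.2 ⟨?_, fun F' hF' => ?_⟩⟩
      · exact ⟨hfin.mem_toFinset.2 ⟨hF, h3⟩, heF⟩
      · obtain ⟨hF'', h3'⟩ := hfin.mem_toFinset.1 hF'.1
        exact D.eq_of_mem_boundaryEdges_of_faceLength_eq_three hC hG hF'' hF h3' h3 hF'.2 heF
  have hthree : ∀ F ∈ hfin.toFinset, (D.boundaryEdges F).ncard = 3 := fun F hF => by
    obtain ⟨hF, h3⟩ := hfin.mem_toFinset.1 hF
    exact (D.isTriangleEdges_of_faceLength_eq_three hF h3).ncard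
  have hsub : D.uncoveredEdges ⊆ G.edgeSet := fun e he => he.1
  rw [Finset.sum_congr rfl hthree, Finset.sum_const, smul_eq_mul, mul_comm, one_mul,
    ← ncard_eq_toFinset_card _ hfin] at hcovered
  rw [numFaces, hcovered, tau, ncard_sdiff_add_ncard_of_subset hsub (toFinite _)]

theorem faceLength_le_maxFaceLength (hF : F ∈ D.faces) : D.faceLength F ≤ D.maxFaceLength :=
  le_csSup (D.finite_faces.image _).bddAbove (mem_image_of_mem _ hF)

theorem sum_numFaces_smul {M : Type*} [AddCommMonoid M] {K : Finset ℕ} {w : ℕ → M}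
    (h : ∀ F ∈ D.faces, D.faceLength F ∉ K → w (D.faceLength F) = 0) :
    ∑ k ∈ K, D.numFaces k • w k = ∑ F ∈ D.finite_faces.toFinset, w (D.faceLength F) := by
  classical
  have hK : ∀ F ∈ D.finite_faces.toFinset, w (D.faceLength F) ≠ 0 → D.faceLength F ∈ K :=
    fun F hF => not_imp_comm.1 (h F (D.finite_faces.mem_toFinset.1 hF))
  rw [← Finset.sum_filter_of_ne hK, ← Finset.sum_fiberwise_of_maps_to (t := K)
    fun F hF => (Finset.mem_filter.1 hF).2]
  refine Finset.sum_congr rfl fun k hk => ?_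
  rw [Finset.sum_congr rfl fun F hF => by rw [(Finset.mem_filter.1 hF).2], Finset.sum_const,
    numFaces, ← ncard_coe_finset]
  congr 2
  ext F
  simp only [mem_ofPred_eq, Finset.coe_filter, Finset.mem_filter, D.finite_faces.mem_toFinset]
  exact ⟨fun hF => ⟨⟨hF.1, hF.2 ▸ hk⟩, hF.2⟩, fun hF => ⟨hF.1.1, hF.2⟩⟩

theorem sum_numFaces_mul_sub_five (hC : (SimpleGraph.cycleGraph 4).Free G)
    (hG : 3 ≤ G.edgeSet.ncard) :
    ∑ k ∈ Finset.Icc 6 D.maxFaceLength, (D.numFaces k : ℝ) * ((k : ℝ) - 5) =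
      2 * (G.edgeSet.ncard : ℝ) - 5 * (D.faces.ncard : ℝ) + 2 * (D.numFaces 3 : ℝ) := by
  have hsum := D.sum_numFaces_smul (K := insert 3 (Finset.Icc 6 D.maxFaceLength))
    (w := fun k => (k : ℝ) - 5) fun F hF hK => by
      rw [Finset.mem_insert, Finset.mem_Icc, not_or] at hK
      have := D.faceLength_le_maxFaceLength hF
      have h5 : D.faceLength F = 5 := by
        have := D.faceLength_eq_three_or_five_le hC hG hF
        omega
      rw [h5]
      norm_num
  have hlength : ∑ F ∈ D.finite_faces.toFinset, (D.faceLength F : ℝ) = 2 * G.edgeSet.ncard := by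
    exact_mod_cast D.sum_faceLength
  rw [Finset.sum_insert (by simp), Finset.sum_sub_distrib, hlength, Finset.sum_const,
    ← ncard_eq_toFinset_card _ D.finite_faces] at hsum
  simp only [nsmul_eq_mul, Nat.cast_ofNat] at hsum
  linarith

theorem ncard_edgeSet_eq (hC : (SimpleGraph.cycleGraph 4).Free G) (hε : 3 ≤ G.edgeSet.ncard)
    (hG : ¬ IsTriangleEdges G G.edgeSet) :
    (G.edgeSet.ncard : ℝ) =
      15 / 7 * ((Nat.card V : ℝ) - 1 - Nat.card G.ConnectedComponent) - 2 / 7 * (D.tau : ℝ)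
        - ∑ k ∈ Finset.Icc 6 D.maxFaceLength, 3 * ((k : ℝ) - 5) / 7 * (D.numFaces k : ℝ) := by
  have heuler : (D.faces.ncard : ℝ) + Nat.card V =
      G.edgeSet.ncard + Nat.card G.ConnectedComponent + 1 := by
    exact_mod_cast D.ncard_faces_add_card
  have htau : 3 * (D.numFaces 3 : ℝ) + D.tau = G.edgeSet.ncard := by
    exact_mod_cast D.three_mul_numFaces_add_tau hC hG
  have hsum : ∑ k ∈ Finset.Icc 6 D.maxFaceLength, 3 * ((k : ℝ) - 5) / 7 * (D.numFaces k : ℝ) =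
      3 / 7 * ∑ k ∈ Finset.Icc 6 D.maxFaceLength, (D.numFaces k : ℝ) * ((k : ℝ) - 5) := by
    rw [Finset.mul_sum]
    exact Finset.sum_congr rfl fun k _ => by ring
  rw [hsum, D.sum_numFaces_mul_sub_five hC hε]
  linarith

theorem ncard_edgeSet_le (D : PlaneEmbedding G) (hC : (SimpleGraph.cycleGraph 4).Free G)
    (hn : 4 ≤ Nat.card V) : (G.edgeSet.ncard : ℝ) ≤ 15 / 7 * ((Nat.card V : ℝ) - 2) := by
  have hn' : (4 : ℝ) ≤ Nat.card V := by exact_mod_cast hn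
  obtain h4 | h5 := le_or_gt G.edgeSet.ncard 4
  · have h4' : (G.edgeSet.ncard : ℝ) ≤ 4 := by exact_mod_cast h4
    linarith
  have : Nonempty V := (Nat.card_pos_iff.1 (by omega)).1
  have hc : (1 : ℝ) ≤ Nat.card G.ConnectedComponent := by exact_mod_cast Nat.card_pos
  have hsum : 0 ≤ ∑ k ∈ Finset.Icc 6 D.maxFaceLength,
      3 * ((k : ℝ) - 5) / 7 * (D.numFaces k : ℝ) := by
    refine Finset.sum_nonneg fun k hk => ?_
    have h6 : (6 : ℝ) ≤ k := by exact_mod_cast (Finset.mem_Icc.1 hk).1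
    have : 0 ≤ (k : ℝ) - 5 := by linarith
    positivity
  have heq := D.ncard_edgeSet_eq hC (by omega) fun hT => by
    have := hT.ncard
    omega
  linarith

end PlaneEmbedding

end Counting

theorem theorem3_general {V : Type*} [Finite V] (G : SimpleGraph V) (D : PlaneEmbedding G) :
    D.faces.Finite ∧
    (D.TrianglesBoundFaces → D.tau = (edgesInNoTriangle G).ncard) ∧
    ((SimpleGraph.cycleGraph 4).Free G →
      (4 ≤ Nat.card V → (G.edgeSet.ncard : ℝ) ≤ 15 / 7 * ((Nat.card V : ℝ) - 2)) ∧
      (3 ≤ G.edgeSet.ncard → ¬ IsTriangleEdges G G.edgeSet →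
        (G.edgeSet.ncard : ℝ) =
          15 / 7 * ((Nat.card V : ℝ) - 1 - Nat.card G.ConnectedComponent) - 2 / 7 * (D.tau : ℝ)
            - ∑ k ∈ Finset.Icc 6 D.maxFaceLength, 3 * ((k : ℝ) - 5) / 7 * (D.numFaces k : ℝ))) :=
  ⟨D.finite_faces, D.tau_eq_ncard_edgesInNoTriangle,
    fun hC => ⟨D.ncard_edgeSet_le hC, D.ncard_edgeSet_eq hC⟩⟩

theorem theorem3 {V : Type*} [Fintype V] (G : SimpleGraph V) (D : PlaneEmbedding G)
    (hn : 4 ≤ Fintype.card V) (hC4 : (SimpleGraph.cycleGraph 4).Free G) :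
    (G.edgeSet.ncard : ℝ) ≤ 15 / 7 * ((Fintype.card V : ℝ) - 2) ∧
    (G.Connected →
      D.faces.Finite ∧
      (G.edgeSet.ncard : ℝ) = 15 / 7 * ((Fintype.card V : ℝ) - 2) - 2 / 7 * (D.tau : ℝ)
        - ∑ k ∈ Finset.Icc 6 D.maxFaceLength, 3 * ((k : ℝ) - 5) / 7 * (D.numFaces k : ℝ) ∧
      (D.TrianglesBoundFaces → D.tau = (edgesInNoTriangle G).ncard)) := by
  obtain ⟨hfin, htau, hC⟩ := theorem3_general G D
  rw [← Nat.card_eq_fintype_card] at hn ⊢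
  obtain ⟨hle, heq⟩ := hC hC4
  refine ⟨hle hn, fun hG => ⟨hfin, ?_, htau⟩⟩
  rw [heq (three_le_ncard_edgeSet_of_connected hG hn)
    (not_isTriangleEdges_edgeSet_of_connected hG hn), card_connectedComponent_of_connected hG]
  ring
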